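/- **Conventions.** $\mathcal F$ is the category whose objects are the positive integers and whose morphisms $n\to m$ are the finite ordered rooted binary forests with $n$ roots and $m$ leaves; $p\circ q$ is obtained by attaching the $i$-th root of $p$ to the $i$-th leaf of $q$. $\mathcal{SF}$ is the category of symmetric forests, with $\mathcal{SF}(n,m)=\mathcal F(n,m)\times S_m$; the pair $(p,\sigma)$ is the diagram $\sigma\circ p$ in which the $j$-th leaf of $p$ is joined to the point number $\sigma(j)$, and diagrams are composed by stacking. If a category $\mathcal C$ admits a calculus of left fractions at an object $e$, its group of fractions is the set of pairs $(t,s)$ of morphisms with source $e$ and common target, modulo the equivalence relation generated by $(t,s)\sim(ft,fs)$, with $\frac ts\cdot\frac{t'}{s'}=\frac{ft}{f's'}$ whenever $fs=f't'$. Thompson's group $V$ is the group of fractions of $(\mathcal{SF},1)$. Let $\Gamma$ be a group with neutral element $e$, let $S:\Gamma\to\Gamma\times\Gamma$, $S(g)=(g,e)$, and let $\Xi$ be the monoidal functor from $\mathcal F$ to the category of groups (with direct products) such that $\Xi(1)=\Gamma$ and $\Xi(Y)=S$, where $Y$ is the tree with two leaves; thus $\Xi(n)=\Gamma^n$. Let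 $\mathscr G=\varinjlim_t\Gamma_t$ be the limit group over all trees $t$, where $\Gamma_t$ is a copy of $\Gamma^n$ if $t$ has $n$ leaves: its elements are the classes $\frac tx$ of pairs $(t,x)$, $x\in\Gamma_t$, for the equivalence relation generated by $(t,x)\sim(ft,\Xi(f)x)$ with $f$ a forest. Let $\pi_\Xi:V\curvearrowright\mathscr G$ be the Jones action, which is by automorphisms and is given by $$\pi_\Xi\!\left(\frac{\theta\circ t}{\sigma\circ s}\right)\frac sx=\frac{t}{\mathrm{Tens}(\theta^{-1}\sigma)x},\qquad \mathrm{Tens}(\kappa)(x_1,\dots,x_n)=(x_{\kappa^{-1}(1)},\dots,x_{\kappa^{-1}(n)}),$$ for trees $t,s$ with $n$ leaves, $\theta,\sigma\in S_n$ and $x\in\Gamma^n$. Let $\mathbf Q_2$ be the set of dyadic rationals in $[0,1)$, on which $V$ acts as follows: if $(I_1,\dots,I_n)$ and $(J_1,\dots,J_n)$ are the standard dyadic partitions of $[0,1)$ associated to the trees $s$ and $t$, then $\frac{\tau\circ t}{\sigma\circ s}$ maps $I_{\sigma^{-1}(i)}$ onto $J_{\tau^{-1}(i)}$ by the increasing affine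 bijection, for every $i$. Let $\oplus_{\mathbf Q_2}\Gamma$ be the group of finitely supported maps $\mathbf Q_2\to\Gamma$, with the Bernoulli shift action of $V$, $(v\cdot g)(d)=g(v^{-1}d)$. Let $\mathcal C_\Xi$ be the category whose objects are the positive integers, with $\mathcal C_\Xi(n,m)=\mathcal F(n,m)\times S_m\times\Gamma^m$, and whose composition is determined by that of $\mathcal{SF}$, the product of $\Gamma^m$, and the rules $f\circ g=\Xi(f)(g)\circ f$ for a forest $f\in\mathcal F(n,m)$ and $g\in\Gamma^n$, and $\sigma\circ g=\mathrm{Tens}(\sigma)(g)\circ\sigma$ for $\sigma\in S_n$ and $g\in\Gamma^n$. **Proposition.** There is a group isomorphism $\Psi:\mathscr G\to\oplus_{\mathbf Q_2}\Gamma$ that intertwines the Jones action and the Bernoulli shift: $\Psi(\pi_\Xi(v)z)=v\cdot\Psi(z)$ for all $v\in V$ and $z\in\mathscr G$. In particular, the group of fractions of $\mathcal C_\Xi$ at the object $1$ is isomorphic to the semi-direct product $\oplus_{\mathbf Q_2}\Gamma\rtimes V$ for the Bernoulli shift. -/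

import Mathlib

open CategoryTheory

universe w v u

namespace JonesThompson

/-! ### Groups of fractions and Jones actions -/

section General

variable {C : Type u} [Category.{v} C]

/-- The category `C` admits a calculus of left fractions at the object `e`. In Mathlib's
diagrammatic notation `t ≫ f` is the composition `f ∘ t`. -/
class LeftCalculus (e : C) : Prop where
  ore : ∀ {a b : C} (p : e ⟶ a) (q : e ⟶ b), ∃ (c : C) (h : a ⟶ c) (k : b ⟶ c), p ≫ h = q ≫ k
  weakCancel : ∀ {a b : C} (f : e ⟶ a) (p q : a ⟶ b), f ≫ p = f ≫ q →
    ∃ (c : C) (g : b ⟶ c), p ≫ g = q ≫ g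

variable (C) in
/-- A covariant functor from `C` to sets, written with plain functions. -/
structure SetFunctor where
  obj : C → Type w
  map : ∀ {a b : C}, (a ⟶ b) → obj a → obj b
  map_id : ∀ (a : C) (x : obj a), map (𝟙 a) x = x
  map_comp : ∀ {a b c : C} (f : a ⟶ b) (g : b ⟶ c) (x : obj a), map (f ≫ g) x = map g (map f x)

/-- The functor of morphisms with source `e`. -/
abbrev SetFunctor.hom (e : C) : SetFunctor.{v} C where
  obj b := e ⟶ b
  map f s := s ≫ f
  map_id := by simp
  map_comp := by simp

/-- The functor to sets underlying a functor to groups. -/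
abbrev SetFunctor.ofGrp (Φ : C ⥤ GrpCat.{w}) : SetFunctor.{w} C where
  obj b := Φ.obj b
  map f x := (Φ.map f).hom x
  map_id := by simp
  map_comp := by simp

/-- Pairs `(t, x)` with `t` a morphism with source `e` and `x` in the value of the functor at the
target of `t`. -/
structure LimPair (e : C) (X : SetFunctor.{w} C) where
  target : C
  tree : e ⟶ target
  val : X.obj target

/-- The elementary relation `(t, x) ∼ (f ∘ t, X(f)(x))`. -/
inductive LimPair.Step (e : C) (X : SetFunctor.{w} C) : LimPair e X → LimPair e X → Prop
  | intro {a b : C} (t : e ⟶ a) (x : X.obj a) (f : a ⟶ b) :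
      LimPair.Step e X ⟨a, t, x⟩ ⟨b, t ≫ f, X.map f x⟩

/-- The inductive limit of `X` along the morphisms with source `e`: pairs `(t, x)` modulo the
equivalence relation generated by `(t, x) ∼ (f ∘ t, X(f)(x))`. -/
def Lim (e : C) (X : SetFunctor.{w} C) : Type (max u v w) := Quot (LimPair.Step e X)

/-- The class of the pair `(t, x)`, that is the fraction `t / x`. -/
def Lim.mk {e : C} {X : SetFunctor.{w} C} {a : C} (t : e ⟶ a) (x : X.obj a) : Lim e X :=
  Quot.mk _ ⟨a, t, x⟩

namespace Lim

variable {e : C} {X : SetFunctor.{w} C}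

theorem ind {P : Lim e X → Prop} (h : ∀ (a : C) (t : e ⟶ a) (x : X.obj a), P (mk t x))
    (z : Lim e X) : P z := by
  obtain ⟨⟨a, t, x⟩, rfl⟩ := Quot.exists_rep z
  exact h a t x

theorem mk_ext {a b : C} (t : e ⟶ a) (x : X.obj a) (f : a ⟶ b) :
    (mk (t ≫ f) (X.map f x) : Lim e X) = mk t x :=
  (Quot.sound (LimPair.Step.intro t x f)).symm

variable [LeftCalculus e]

theorem mk_eq_mk_iff {a b : C} {t : e ⟶ a} {x : X.obj a} {s : e ⟶ b} {y : X.obj b} :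
    (mk t x : Lim e X) = mk s y ↔
      ∃ (c : C) (p : a ⟶ c) (q : b ⟶ c), t ≫ p = s ≫ q ∧ X.map p x = X.map q y := by
  constructor
  · intro h
    have key : ∀ z z' : LimPair e X, Relation.EqvGen (LimPair.Step e X) z z' →
        ∃ (c : C) (p : z.target ⟶ c) (q : z'.target ⟶ c),
          z.tree ≫ p = z'.tree ≫ q ∧ X.map p z.val = X.map q z'.val := by
      intro z z' hz
      induction hz with
      | rel z z' h =>
        obtain ⟨t, x, f⟩ := h
        exact ⟨_, f, 𝟙 _, by simp, by simp [X.map_id]⟩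
      | refl z => exact ⟨_, 𝟙 _, 𝟙 _, rfl, rfl⟩
      | symm z z' _ ih =>
        obtain ⟨c, p, q, h1, h2⟩ := ih
        exact ⟨c, q, p, h1.symm, h2.symm⟩
      | trans z z' z'' _ _ ih1 ih2 =>
        obtain ⟨c, p, q, h1, h2⟩ := ih1
        obtain ⟨d, p', q', h1', h2'⟩ := ih2
        obtain ⟨k, f, g, hfg⟩ := LeftCalculus.ore (z'.tree ≫ q) (z'.tree ≫ p')
        obtain ⟨l, g', hg'⟩ := LeftCalculus.weakCancel z'.tree (q ≫ f) (p' ≫ g)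
          (by simpa using hfg)
        refine ⟨l, p ≫ f ≫ g', q' ≫ g ≫ g', ?_, ?_⟩
        · simp only [← Category.assoc] at *
          rw [h1, hfg, h1']
        · have h3 := congrArg (fun r => X.map r z'.val) hg'
          simp only [X.map_comp] at *
          rw [h2, h3, h2']
    exact key _ _ (Quot.eqvGen_exact h)
  · rintro ⟨c, p, q, h1, h2⟩
    rw [← mk_ext t x p, ← mk_ext s y q, h1, h2]

/-- The formula of the Jones action on representatives does not depend on choices. -/
theorem act_aux {a b c d : C} (t s : e ⟶ a) (r : e ⟶ b) (x : X.obj b)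
    (p : a ⟶ c) (q : b ⟶ c) (p' : a ⟶ d) (q' : b ⟶ d)
    (h : s ≫ p = r ≫ q) (h' : s ≫ p' = r ≫ q') :
    (mk (t ≫ p) (X.map q x) : Lim e X) = mk (t ≫ p') (X.map q' x) := by
  obtain ⟨k, f, g, hfg⟩ := LeftCalculus.ore (s ≫ p) (s ≫ p')
  obtain ⟨l, m, hm⟩ := LeftCalculus.weakCancel s (p ≫ f) (p' ≫ g) (by simpa using hfg)
  obtain ⟨n, o, ho⟩ := LeftCalculus.weakCancel r (q ≫ f ≫ m) (q' ≫ g ≫ m) (by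
    have h2 : s ≫ (p ≫ f) ≫ m = s ≫ (p' ≫ g) ≫ m := by rw [hm]
    simp only [← Category.assoc] at *
    rw [← h, ← h', h2])
  rw [← mk_ext (t ≫ p) _ (f ≫ m ≫ o), ← mk_ext (t ≫ p') _ (g ≫ m ≫ o)]
  congr 1
  · have := congrArg (fun r => t ≫ r ≫ o) hm
    simpa using this
  · have := congrArg (fun r => X.map r x) ho
    simpa [← X.map_comp] using this

/-- `(t / s) · (r / x) = (p ∘ t) / X(q)(x)` for any `p, q` with `p ∘ s = q ∘ r`. -/
noncomputable def act (g : Lim e (SetFunctor.hom e)) (z : Lim e X) : Lim e X :=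
  Quot.liftOn₂ g z
    (fun g z =>
      mk (g.tree ≫ (LeftCalculus.ore (g.val : e ⟶ g.target) z.tree).choose_spec.choose)
        (X.map (LeftCalculus.ore (g.val : e ⟶ g.target) z.tree).choose_spec.choose_spec.choose
          z.val))
    (by
      rintro ⟨a, t, s⟩ _ _ ⟨r, x, f⟩
      have h1 := (LeftCalculus.ore (s : e ⟶ a) r).choose_spec.choose_spec.choose_spec
      have h2 := (LeftCalculus.ore (s : e ⟶ a) (r ≫ f)).choose_spec.choose_spec.choose_spec
      dsimp only at *
      rw [← X.map_comp]
      exact act_aux t s r x _ _ _ _ h1 (h2.trans (Category.assoc _ _ _)))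
    (by
      rintro _ _ ⟨b, r, x⟩ ⟨t, s, f⟩
      have h1 := (LeftCalculus.ore (s : e ⟶ _) r).choose_spec.choose_spec.choose_spec
      have h2 := (LeftCalculus.ore (s ≫ f : e ⟶ _) r).choose_spec.choose_spec.choose_spec
      dsimp only [SetFunctor.hom] at *
      rw [Category.assoc]
      exact act_aux t s r x _ _ _ _ h1 ((Category.assoc _ _ _).symm.trans h2))

theorem act_mk {a b c : C} (t s : e ⟶ a) (r : e ⟶ b) (x : X.obj b) (p : a ⟶ c) (q : b ⟶ c)
    (h : s ≫ p = r ≫ q) :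
    act (mk t s : Lim e (SetFunctor.hom e)) (mk r x : Lim e X) = mk (t ≫ p) (X.map q x) :=
  act_aux t s r x _ _ p q (LeftCalculus.ore s r).choose_spec.choose_spec.choose_spec h

theorem act_mk_same {a : C} (t s : e ⟶ a) (x : X.obj a) :
    act (mk t s : Lim e (SetFunctor.hom e)) (mk s x : Lim e X) = mk t x := by
  rw [act_mk t s s x (𝟙 a) (𝟙 a) rfl, X.map_id, Category.comp_id]

/-- Two classes have representatives with a common first entry. -/
theorem exists_common {Y : SetFunctor.{w} C} (z : Lim e X) (z' : Lim e Y) :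
    ∃ (a : C) (t : e ⟶ a) (x : X.obj a) (y : Y.obj a), z = mk t x ∧ z' = mk t y := by
  induction z using ind with | h a t x =>
  induction z' using ind with | h b s y =>
  obtain ⟨c, p, q, h⟩ := LeftCalculus.ore t s
  exact ⟨c, t ≫ p, X.map p x, Y.map q y, (mk_ext _ _ _).symm, by rw [h, mk_ext]⟩

theorem exists_common₃ (z z' z'' : Lim e X) :
    ∃ (a : C) (t : e ⟶ a) (x y y' : X.obj a), z = mk t x ∧ z' = mk t y ∧ z'' = mk t y' := by
  obtain ⟨a, t, x, y, rfl, rfl⟩ := exists_common z z'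
  induction z'' using ind with | h b s y' =>
  obtain ⟨c, p, q, h⟩ := LeftCalculus.ore t s
  exact ⟨c, t ≫ p, X.map p x, X.map p y, X.map q y', (mk_ext _ _ _).symm, (mk_ext _ _ _).symm,
    by rw [h, mk_ext]⟩

theorem act_act (g h : Lim e (SetFunctor.hom e)) (z : Lim e X) :
    act (act g h) z = act g (act h z) := by
  induction g using ind with | h a t s =>
  induction h using ind with | h b t' s' =>
  induction z using ind with | h c r x =>
  obtain ⟨d, p, q, hpq⟩ := LeftCalculus.ore (s : e ⟶ a) t'
  obtain ⟨k, p', q', hpq'⟩ := LeftCalculus.ore ((s' : e ⟶ b) ≫ q) r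
  rw [act_mk t s t' s' p q hpq, act_mk t' s' r x (q ≫ p') q' (by rw [← Category.assoc]; exact hpq'),
    act_mk t s (t' ≫ q ≫ p') _ (p ≫ p') (𝟙 _)
      (by rw [Category.comp_id, ← Category.assoc, ← Category.assoc, ← hpq])]
  refine (act_mk (t ≫ p) ((s' : e ⟶ b) ≫ q) r x p' q' hpq').trans ?_
  rw [X.map_id, Category.assoc]

end Lim

/-- The group of fractions of `(C, e)`: pairs `(t, s)` of morphisms with source `e` and common
target, modulo the equivalence relation generated by `(t, s) ∼ (f ∘ t, f ∘ s)`. -/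
def FractionGroup (e : C) : Type (max u v) := Lim e (SetFunctor.hom e)

namespace FractionGroup

variable {e : C}

/-- The fraction `t / s`. -/
def mk {a : C} (t s : e ⟶ a) : FractionGroup e := Lim.mk (X := SetFunctor.hom e) t s

theorem ind {P : FractionGroup e → Prop} (h : ∀ (a : C) (t s : e ⟶ a), P (mk t s))
    (z : FractionGroup e) : P z := Lim.ind h z

theorem mk_ext {a b : C} (t s : e ⟶ a) (f : a ⟶ b) : mk (t ≫ f) (s ≫ f) = mk t s :=
  Lim.mk_ext (X := SetFunctor.hom e) t s f

theorem mk_self {a : C} (t : e ⟶ a) : mk t t = mk (𝟙 e) (𝟙 e) := by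
  simpa using mk_ext (𝟙 e) (𝟙 e) t

/-- The inverse of `t / s` is `s / t`. -/
def inv (g : FractionGroup e) : FractionGroup e :=
  Quot.lift (fun g => (mk (g.val : e ⟶ g.target) g.tree : FractionGroup e))
    (by rintro _ _ ⟨t, s, f⟩; exact (mk_ext s t f).symm) g

variable [LeftCalculus e]

noncomputable instance : Group (FractionGroup e) :=
  { mul := fun g h => Lim.act g h
    one := mk (𝟙 e) (𝟙 e)
    inv := inv
    mul_assoc := fun g h k => Lim.act_act g h k
    one_mul := fun g => by
      induction g using ind with | h a t s =>
      change Lim.act (mk (𝟙 e) (𝟙 e)) (mk t s) = mk t s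
      rw [← mk_self t]
      exact Lim.act_mk_same (X := SetFunctor.hom e) t t s
    mul_one := fun g => by
      induction g using ind with | h a t s =>
      change Lim.act (mk t s) (mk (𝟙 e) (𝟙 e)) = mk t s
      rw [← mk_self s]
      exact Lim.act_mk_same (X := SetFunctor.hom e) t s s
    inv_mul_cancel := fun g => by
      induction g using ind with | h a t s =>
      change Lim.act (mk s t) (mk t s) = mk (𝟙 e) (𝟙 e)
      rw [← mk_self s]
      exact Lim.act_mk_same (X := SetFunctor.hom e) s t s }

theorem mk_mul_mk {a b c : C} (t s : e ⟶ a) (t' s' : e ⟶ b) (f : a ⟶ c) (f' : b ⟶ c)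
    (h : s ≫ f = t' ≫ f') : mk t s * mk t' s' = mk (t ≫ f) (s' ≫ f') :=
  Lim.act_mk (X := SetFunctor.hom e) t s t' s' f f' h

theorem mk_inv {a : C} (t s : e ⟶ a) : (mk t s)⁻¹ = mk s t := rfl

end FractionGroup

/-- The limit group of a functor to groups, along the morphisms with source `e`. -/
def LimitGroup (Φ : C ⥤ GrpCat.{w}) (e : C) : Type (max u v w) := Lim e (SetFunctor.ofGrp Φ)

namespace LimitGroup

variable {e : C} {Φ : C ⥤ GrpCat.{w}}

/-- The fraction `t / x`, that is the class of `x` viewed in the copy of the group `Φ(b)` indexed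
by the morphism `t : e ⟶ b`. -/
def mk {a : C} (t : e ⟶ a) (x : Φ.obj a) : LimitGroup Φ e := Lim.mk (X := SetFunctor.ofGrp Φ) t x

theorem ind {P : LimitGroup Φ e → Prop} (h : ∀ (a : C) (t : e ⟶ a) (x : Φ.obj a), P (mk t x))
    (z : LimitGroup Φ e) : P z := Lim.ind h z

theorem mk_ext {a b : C} (t : e ⟶ a) (x : Φ.obj a) (f : a ⟶ b) :
    (mk (t ≫ f) ((Φ.map f).hom x) : LimitGroup Φ e) = mk t x :=
  Lim.mk_ext (X := SetFunctor.ofGrp Φ) t x f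

theorem mk_one {a : C} (t : e ⟶ a) : (mk t 1 : LimitGroup Φ e) = mk (𝟙 e) 1 := by
  simpa using mk_ext (Φ := Φ) (𝟙 e) 1 t

/-- The inverse in the limit group. -/
def inv (z : LimitGroup Φ e) : LimitGroup Φ e :=
  Quot.lift (fun z => (mk z.tree (show Φ.obj z.target from z.val)⁻¹ : LimitGroup Φ e))
    (by
      rintro _ _ ⟨t, x, f⟩
      exact (mk_ext t (x⁻¹ : Φ.obj _) f).symm.trans
        (congrArg (mk (t ≫ f)) (map_inv (Φ.map f).hom x))) z

variable [LeftCalculus e]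

theorem mk_eq_mk_iff {a b : C} {t : e ⟶ a} {x : Φ.obj a} {s : e ⟶ b} {y : Φ.obj b} :
    (mk t x : LimitGroup Φ e) = mk s y ↔
      ∃ (c : C) (p : a ⟶ c) (q : b ⟶ c),
        t ≫ p = s ≫ q ∧ (Φ.map p).hom x = (Φ.map q).hom y :=
  Lim.mk_eq_mk_iff (X := SetFunctor.ofGrp Φ)

theorem exists_common (z z' : LimitGroup Φ e) :
    ∃ (a : C) (t : e ⟶ a) (x y : Φ.obj a), z = mk t x ∧ z' = mk t y :=
  Lim.exists_common z z'

theorem exists_common₃ (z z' z'' : LimitGroup Φ e) :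
    ∃ (a : C) (t : e ⟶ a) (x y y' : Φ.obj a), z = mk t x ∧ z' = mk t y ∧ z'' = mk t y' :=
  Lim.exists_common₃ z z' z''

theorem mul_aux {a b : C} {t : e ⟶ a} {x x' : Φ.obj a} {s : e ⟶ b} {y y' : Φ.obj b}
    (h : (mk t x : LimitGroup Φ e) = mk s y) (h' : (mk t x' : LimitGroup Φ e) = mk s y') :
    (mk t (x * x') : LimitGroup Φ e) = mk s (y * y') := by
  rw [mk_eq_mk_iff] at *
  obtain ⟨c, p, q, h1, h2⟩ := h
  obtain ⟨d, p', q', h1', h2'⟩ := h'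
  obtain ⟨k, f, g, hfg⟩ := LeftCalculus.ore (t ≫ p) (t ≫ p')
  obtain ⟨l, m, hm⟩ := LeftCalculus.weakCancel t (p ≫ f) (p' ≫ g) (by simpa using hfg)
  obtain ⟨n, o, ho⟩ := LeftCalculus.weakCancel s (q ≫ f ≫ m) (q' ≫ g ≫ m) (by
    have h2 : t ≫ (p ≫ f) ≫ m = t ≫ (p' ≫ g) ≫ m := by rw [hm]
    simp only [← Category.assoc] at *
    rw [← h1, ← h1', h2])
  refine ⟨n, p ≫ f ≫ m ≫ o, q ≫ f ≫ m ≫ o, ?_, ?_⟩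
  · simp only [← Category.assoc] at *
    rw [h1]
  · have e1 : p ≫ f ≫ m ≫ o = p' ≫ g ≫ m ≫ o := by
      simp only [← Category.assoc] at *
      rw [hm]
    have e2 : q ≫ f ≫ m ≫ o = q' ≫ g ≫ m ≫ o := by
      simpa only [Category.assoc] using ho
    have k1 : (Φ.map (p ≫ f ≫ m ≫ o)).hom x = (Φ.map (q ≫ f ≫ m ≫ o)).hom y := by
      simp only [Φ.map_comp, GrpCat.hom_comp, MonoidHom.comp_apply]
      rw [h2]
    have k2 : (Φ.map (p ≫ f ≫ m ≫ o)).hom x' = (Φ.map (q ≫ f ≫ m ≫ o)).hom y' := by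
      rw [e1, e2]
      simp only [Φ.map_comp, GrpCat.hom_comp, MonoidHom.comp_apply]
      rw [h2']
    rw [map_mul, map_mul, k1, k2]

/-- The product of `t / x` and `t / y` is `t / (x y)`. -/
noncomputable def mul (z z' : LimitGroup Φ e) : LimitGroup Φ e :=
  mk (exists_common z z').choose_spec.choose
    ((exists_common z z').choose_spec.choose_spec.choose *
      (exists_common z z').choose_spec.choose_spec.choose_spec.choose)

theorem mul_mk {a : C} (t : e ⟶ a) (x y : Φ.obj a) :
    mul (mk t x : LimitGroup Φ e) (mk t y) = mk t (x * y) := by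
  have h := (exists_common (mk t x : LimitGroup Φ e) (mk t y)).choose_spec.choose_spec.choose_spec.choose_spec
  exact mul_aux h.1.symm h.2.symm

noncomputable instance : Group (LimitGroup Φ e) :=
  { mul := mul
    one := mk (𝟙 e) 1
    inv := inv
    mul_assoc := fun z z' z'' => by
      obtain ⟨a, t, x, y, y', rfl, rfl, rfl⟩ := exists_common₃ z z' z''
      change mul (mul _ _) _ = mul _ (mul _ _)
      simp only [mul_mk, mul_assoc]
    one_mul := fun z => by
      induction z using ind with | h a t x =>
      change mul (mk (𝟙 e) 1) (mk t x) = mk t x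
      rw [← mk_one t, mul_mk, one_mul]
    mul_one := fun z => by
      induction z using ind with | h a t x =>
      change mul (mk t x) (mk (𝟙 e) 1) = mk t x
      rw [← mk_one t, mul_mk, mul_one]
    inv_mul_cancel := fun z => by
      induction z using ind with | h a t x =>
      change mul (mk t x⁻¹) (mk t x) = mk (𝟙 e) 1
      rw [← mk_one t, mul_mk, inv_mul_cancel] }

theorem mk_mul_mk {a : C} (t : e ⟶ a) (x y : Φ.obj a) :
    (mk t x * mk t y : LimitGroup Φ e) = mk t (x * y) := mul_mk t x y

end LimitGroup

/-- The Jones action of the group of fractions on the limit group, by group automorphisms: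
`(t / s) · (r / x) = (p ∘ t) / Φ(q)(x)` for any `p, q` with `p ∘ s = q ∘ r`. -/
noncomputable def jonesAction (Φ : C ⥤ GrpCat.{w}) (e : C) [LeftCalculus e] :
    FractionGroup e →* MulAut (LimitGroup Φ e) where
  toFun g :=
    { toFun := fun z => Lim.act g z
      invFun := fun z => Lim.act (g⁻¹ : FractionGroup e) z
      left_inv := fun z => by
        induction g using FractionGroup.ind with | h a t s =>
        induction z using LimitGroup.ind with | h b r x =>
        obtain ⟨c, p, q, h⟩ := LeftCalculus.ore s r
        rw [← FractionGroup.mk_ext t s p, ← LimitGroup.mk_ext r x q, h]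
        exact (congrArg _ (Lim.act_mk_same (X := SetFunctor.ofGrp Φ) _ _ _)).trans
          (Lim.act_mk_same _ _ _)
      right_inv := fun z => by
        induction g using FractionGroup.ind with | h a t s =>
        induction z using LimitGroup.ind with | h b r x =>
        obtain ⟨c, p, q, h⟩ := LeftCalculus.ore t r
        rw [← FractionGroup.mk_ext t s p, ← LimitGroup.mk_ext r x q, h]
        exact (congrArg _ (Lim.act_mk_same (X := SetFunctor.ofGrp Φ) _ _ _)).trans
          (Lim.act_mk_same _ _ _)
      map_mul' := fun z z' => by
        obtain ⟨b, r, x, y, rfl, rfl⟩ := LimitGroup.exists_common z z'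
        induction g using FractionGroup.ind with | h a t s =>
        obtain ⟨c, p, q, h⟩ := LeftCalculus.ore s r
        rw [← FractionGroup.mk_ext t s p, ← LimitGroup.mk_ext r x q, ← LimitGroup.mk_ext r y q,
          h, LimitGroup.mk_mul_mk]
        refine (Lim.act_mk_same (X := SetFunctor.ofGrp Φ) _ _ _).trans ?_
        refine (LimitGroup.mk_mul_mk _ _ _).symm.trans ?_
        congr 1
        · exact (Lim.act_mk_same (X := SetFunctor.ofGrp Φ) _ _ _).symm
        · exact (Lim.act_mk_same (X := SetFunctor.ofGrp Φ) _ _ _).symm }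
  map_one' := by
    ext z
    induction z using LimitGroup.ind with | h b r x =>
    change Lim.act (FractionGroup.mk (𝟙 e) (𝟙 e)) (LimitGroup.mk r x) = LimitGroup.mk r x
    rw [← FractionGroup.mk_self r]
    exact Lim.act_mk_same (X := SetFunctor.ofGrp Φ) _ _ _
  map_mul' g h := by
    ext z
    exact Lim.act_act g h z

theorem jonesAction_mk {Φ : C ⥤ GrpCat.{w}} {e : C} [LeftCalculus e] {a b c : C} (t s : e ⟶ a)
    (r : e ⟶ b) (x : Φ.obj b) (p : a ⟶ c) (q : b ⟶ c) (h : s ≫ p = r ≫ q) :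
    jonesAction Φ e (FractionGroup.mk t s) (LimitGroup.mk r x) =
      LimitGroup.mk (t ≫ p) ((Φ.map q).hom x) :=
  Lim.act_mk (X := SetFunctor.ofGrp Φ) t s r x p q h

/-! ### The larger category attached to a functor to groups -/

/-- The objects of the larger category: the same as those of `C`. -/
structure LargeCat (Φ : C ⥤ GrpCat.{w}) where
  base : C

/-- A morphism of the larger category from `a` to `b` is a morphism `base` of `C` together with an
element `label` of the group `Φ(b)`. It stands for the composition `label ∘ base`. -/
@[ext]
structure LargeHom (Φ : C ⥤ GrpCat.{w}) (a b : LargeCat Φ) where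
  base : a.base ⟶ b.base
  label : Φ.obj b.base

/-- The composition is determined by the rule `p ∘ g = Φ(p)(g) ∘ p`, so that
`(h ∘ p) ∘ (g ∘ f) = (h Φ(p)(g)) ∘ (p ∘ f)`. -/
instance (Φ : C ⥤ GrpCat.{w}) : Category (LargeCat Φ) where
  Hom a b := LargeHom Φ a b
  id a := ⟨𝟙 a.base, 1⟩
  comp f p := ⟨f.base ≫ p.base, p.label * (Φ.map p.base).hom f.label⟩
  id_comp f := by ext <;> simp
  comp_id f := by ext <;> simp
  assoc f g h := by ext <;> simp [mul_assoc]

instance (Φ : C ⥤ GrpCat.{w}) (e : C) [LeftCalculus e] :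
    LeftCalculus (⟨e⟩ : LargeCat Φ) where
  ore {a b} p q := by
    obtain ⟨c, h, k, hk⟩ := LeftCalculus.ore p.base q.base
    refine ⟨⟨c⟩, ⟨h, ((Φ.map h).hom p.label)⁻¹⟩, ⟨k, ((Φ.map k).hom q.label)⁻¹⟩, ?_⟩
    refine LargeHom.ext hk ?_
    change _⁻¹ * _ = _⁻¹ * _
    rw [inv_mul_cancel, inv_mul_cancel]
  weakCancel {a b} f p q hpq := by
    have h1 : f.base ≫ p.base = f.base ≫ q.base := congrArg LargeHom.base hpq
    have h2 : p.label * (Φ.map p.base).hom f.label = q.label * (Φ.map q.base).hom f.label :=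
      congrArg LargeHom.label hpq
    obtain ⟨c, r, hr⟩ := LeftCalculus.weakCancel _ _ _ h1
    refine ⟨⟨c⟩, ⟨r, 1⟩, LargeHom.ext hr ?_⟩
    change 1 * (Φ.map r).hom p.label = 1 * (Φ.map r).hom q.label
    have h3 := congrArg (Φ.map r).hom h2
    simp only [map_mul, ← MonoidHom.comp_apply, ← GrpCat.hom_comp, ← Φ.map_comp, hr] at h3
    rw [mul_right_cancel h3]

end General

/-! ### Binary forests -/

/-- Finite ordered rooted binary trees. -/
inductive BTree : Type
  | leaf : BTree
  | node : BTree → BTree → BTree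

namespace BTree

/-- The vertices of a tree are addressed by the path from the root, `false` standing for a left
edge and `true` for a right edge. `t.IsLeaf w` means that `w` is the address of a leaf of `t`. -/
def IsLeaf : BTree → List Bool → Prop
  | leaf, w => w = []
  | node _ _, [] => False
  | node l _, false :: w => IsLeaf l w
  | node _ r, true :: w => IsLeaf r w

/-- The tree obtained by attaching the root of `h w` to the leaf of `t` with address `w`. -/
def graft : BTree → (List Bool → BTree) → BTree
  | leaf, h => h []
  | node l r, h => node (graft l fun w => h (false :: w)) (graft r fun w => h (true :: w))

theorem isLeaf_graft (t : BTree) (h : List Bool → BTree) (w : List Bool) :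
    (t.graft h).IsLeaf w ↔ ∃ w₁ w₂, w = w₁ ++ w₂ ∧ t.IsLeaf w₁ ∧ (h w₁).IsLeaf w₂ := by
  induction t generalizing h w with
  | leaf => simp [graft, IsLeaf]
  | node l r ihl ihr =>
    rcases w with _ | ⟨_ | _, w⟩
    · simp only [graft, IsLeaf, false_iff]
      rintro ⟨w₁, w₂, h1, h2, -⟩
      obtain ⟨rfl, rfl⟩ := List.append_eq_nil_iff.1 h1.symm
      exact h2
    · simp only [graft, IsLeaf, ihl]
      constructor
      · rintro ⟨w₁, w₂, rfl, h1, h2⟩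
        exact ⟨false :: w₁, w₂, rfl, h1, h2⟩
      · rintro ⟨_ | ⟨_ | _, w₁⟩, w₂, h1, h2, h3⟩
        · exact h2.elim
        · exact ⟨w₁, w₂, by simpa using h1, h2, h3⟩
        · simp at h1
    · simp only [graft, IsLeaf, ihr]
      constructor
      · rintro ⟨w₁, w₂, rfl, h1, h2⟩
        exact ⟨true :: w₁, w₂, rfl, h1, h2⟩
      · rintro ⟨_ | ⟨_ | _, w₁⟩, w₂, h1, h2, h3⟩
        · exact h2.elim
        · simp at h1
        · exact ⟨w₁, w₂, by simpa using h1, h2, h3⟩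

theorem IsLeaf.append_inj {t : BTree} {u v u' v' : List Bool} (hu : t.IsLeaf u)
    (hv : t.IsLeaf v) (h : u ++ u' = v ++ v') : u = v := by
  induction t generalizing u v with
  | leaf => rw [show u = [] from hu, show v = [] from hv]
  | node l r ihl ihr =>
    rcases u with _ | ⟨_ | _, u⟩ <;> rcases v with _ | ⟨_ | _, v⟩ <;>
      simp_all [IsLeaf]
    · exact ihl hu hv h
    · exact ihr hu hv h

theorem exists_isLeaf (t : BTree) : ∃ w, t.IsLeaf w := by
  induction t with
  | leaf => exact ⟨[], rfl⟩
  | node l r ihl _ =>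
    obtain ⟨w, hw⟩ := ihl
    exact ⟨false :: w, hw⟩

theorem ext_isLeaf {t s : BTree} (h : ∀ w, t.IsLeaf w ↔ s.IsLeaf w) : t = s := by
  induction t generalizing s with
  | leaf =>
    cases s with
    | leaf => rfl
    | node l r => exact absurd ((h []).1 rfl) id
  | node l r ihl ihr =>
    cases s with
    | leaf => exact absurd ((h []).2 rfl) id
    | node l' r' =>
      rw [ihl fun w => h (false :: w), ihr fun w => h (true :: w)]

theorem finite_isLeaf (t : BTree) : {w | t.IsLeaf w}.Finite := by
  induction t with
  | leaf => exact Set.finite_singleton []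
  | node l r ihl ihr =>
    refine ((ihl.image (List.cons false)).union (ihr.image (List.cons true))).subset ?_
    rintro (_ | ⟨_ | _, w⟩) hw
    · exact hw.elim
    · exact Or.inl ⟨w, hw, rfl⟩
    · exact Or.inr ⟨w, hw, rfl⟩

theorem graft_congr {t : BTree} {h h' : List Bool → BTree} (H : ∀ w, t.IsLeaf w → h w = h' w) :
    t.graft h = t.graft h' := by
  induction t generalizing h h' with
  | leaf => exact H [] rfl
  | node l r ihl ihr =>
    simp only [graft]
    rw [ihl fun w hw => H (false :: w) hw, ihr fun w hw => H (true :: w) hw]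

theorem graft_leaf (t : BTree) : (t.graft fun _ => leaf) = t := by
  induction t with
  | leaf => rfl
  | node l r ihl ihr => simp only [graft, ihl, ihr]

theorem exists_common_graft (t s : BTree) : ∃ h k, t.graft h = s.graft k := by
  induction t generalizing s with
  | leaf => exact ⟨fun _ => s, fun _ => leaf, by rw [graft_leaf]; rfl⟩
  | node l r ihl ihr =>
    cases s with
    | leaf => exact ⟨fun _ => leaf, fun _ => node l r, by rw [graft_leaf]; rfl⟩
    | node l' r' =>
      obtain ⟨h1, k1, e1⟩ := ihl l'
      obtain ⟨h2, k2, e2⟩ := ihr r'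
      refine ⟨fun w => match w with
        | [] => leaf
        | false :: w => h1 w
        | true :: w => h2 w, fun w => match w with
        | [] => leaf
        | false :: w => k1 w
        | true :: w => k2 w, ?_⟩
      simp only [graft, e1, e2]

end BTree

/-- A symmetric forest with `n` roots and `m` leaves: an ordered list of `n` binary trees together
with a numbering of all their leaves by `Fin m`, the leaf number `k` being the leaf with address
`(leafAt k).2` of the tree `tree (leafAt k).1`. The symmetric forest `σ ∘ p`, for a forest `p` and
a permutation `σ`, is the one where the `j`-th leaf of `p`, counted from left to right, has number
`σ j`. -/
@[ext]
structure SymForest (n m : ℕ) where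
  tree : Fin n → BTree
  leafAt : Fin m → Fin n × List Bool
  leafAt_injective : Function.Injective leafAt
  mem_range_leafAt : ∀ x, (∃ k, leafAt k = x) ↔ (tree x.1).IsLeaf x.2

namespace SymForest

variable {n m k l : ℕ}

theorem isLeaf_leafAt (f : SymForest n m) (j : Fin m) :
    (f.tree (f.leafAt j).1).IsLeaf (f.leafAt j).2 := (f.mem_range_leafAt _).1 ⟨j, rfl⟩

theorem ext_leafAt {f g : SymForest n m} (h : ∀ j, f.leafAt j = g.leafAt j) : f = g := by
  refine SymForest.ext (funext fun i => BTree.ext_isLeaf fun w => ?_) (funext h)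
  rw [← f.mem_range_leafAt (i, w), ← g.mem_range_leafAt (i, w)]
  simp only [h]

theorem append_inj (f : SymForest n m) {j j' : Fin m} {v v' : List Bool}
    (h1 : (f.leafAt j).1 = (f.leafAt j').1)
    (h2 : (f.leafAt j).2 ++ v = (f.leafAt j').2 ++ v') : j = j' ∧ v = v' := by
  have hj := f.isLeaf_leafAt j
  rw [h1] at hj
  have h3 := hj.append_inj (f.isLeaf_leafAt j') h2
  rw [h3] at h2
  exact ⟨f.leafAt_injective (Prod.ext h1 h3), List.append_cancel_left h2⟩

/-- The trivial forest, made of `n` trivial trees, with the permutation `σ` on top of it. -/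
def perm (σ : Equiv.Perm (Fin n)) : SymForest n n where
  tree _ := BTree.leaf
  leafAt j := (σ.symm j, [])
  leafAt_injective i j h := by simpa using h
  mem_range_leafAt x := by
    constructor
    · rintro ⟨j, rfl⟩
      rfl
    · intro h
      exact ⟨σ x.1, Prod.ext (by simp) (Eq.symm h)⟩

open Classical in
/-- Stacking the symmetric forest `p` on top of `q`, that is `p ∘ q`: the `j`-th tree of `p` is
attached to the leaf number `j` of `q`. -/
noncomputable def comp (q : SymForest n m) (p : SymForest m k) : SymForest n k where
  tree i := (q.tree i).graft fun w =>
    if h : ∃ j, q.leafAt j = (i, w) then p.tree h.choose else BTree.leaf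
  leafAt c := ((q.leafAt (p.leafAt c).1).1, (q.leafAt (p.leafAt c).1).2 ++ (p.leafAt c).2)
  leafAt_injective c c' h := by
    obtain ⟨h1, h2⟩ := Prod.ext_iff.1 h
    obtain ⟨h3, h4⟩ := q.append_inj h1 h2
    exact p.leafAt_injective (Prod.ext h3 h4)
  mem_range_leafAt x := by
    obtain ⟨i, w⟩ := x
    rw [BTree.isLeaf_graft]
    constructor
    · rintro ⟨c, hc⟩
      obtain ⟨h1, h2⟩ := Prod.ext_iff.1 hc
      dsimp only at h1 h2
      have hq := q.isLeaf_leafAt (p.leafAt c).1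
      rw [h1] at hq
      refine ⟨_, _, h2.symm, hq, ?_⟩
      have hex : ∃ j, q.leafAt j = (i, (q.leafAt (p.leafAt c).1).2) :=
        ⟨(p.leafAt c).1, Prod.ext h1 rfl⟩
      rw [dif_pos hex]
      have : hex.choose = (p.leafAt c).1 :=
        q.leafAt_injective (hex.choose_spec.trans (Prod.ext h1.symm rfl))
      rw [this]
      exact p.isLeaf_leafAt c
    · rintro ⟨w₁, w₂, rfl, h1, h2⟩
      have hex : ∃ j, q.leafAt j = (i, w₁) := (q.mem_range_leafAt (i, w₁)).2 h1
      rw [dif_pos hex] at h2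
      obtain ⟨c, hc⟩ := (p.mem_range_leafAt (hex.choose, w₂)).2 h2
      refine ⟨c, ?_⟩
      rw [hc]
      dsimp only
      rw [hex.choose_spec]

theorem comp_leafAt (q : SymForest n m) (p : SymForest m k) (c : Fin k) :
    (q.comp p).leafAt c =
      ((q.leafAt (p.leafAt c).1).1, (q.leafAt (p.leafAt c).1).2 ++ (p.leafAt c).2) := rfl

theorem comp_assoc (f : SymForest n m) (g : SymForest m k) (h : SymForest k l) :
    (f.comp g).comp h = f.comp (g.comp h) :=
  ext_leafAt fun j => by simp [comp_leafAt]

theorem perm_comp (f : SymForest n m) : (perm 1).comp f = f :=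
  ext_leafAt fun _ => rfl

theorem comp_perm (f : SymForest n m) : f.comp (perm 1) = f :=
  ext_leafAt fun _ => Prod.ext rfl (List.append_nil _)

theorem perm_comp_perm (σ τ : Equiv.Perm (Fin n)) : (perm τ).comp (perm σ) = perm (σ * τ) :=
  ext_leafAt fun _ => rfl

theorem comp_left_cancel (f : SymForest n m) {p q : SymForest m k} (h : f.comp p = f.comp q) :
    p = q := by
  refine ext_leafAt fun j => ?_
  have hj := congrArg (fun r => r.leafAt j) h
  simp only [comp_leafAt, Prod.mk.injEq] at hj
  obtain ⟨h3, h4⟩ := f.append_inj hj.1 hj.2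
  exact Prod.ext h3 h4

/-- The leaves are numbered from left to right: first by the tree they belong to, and inside one
tree by the lexicographic order of their addresses. -/
def Planar (f : SymForest n m) : Prop := StrictMono fun j => toLex (f.leafAt j)

theorem Planar.lt_iff {f : SymForest n m} (hf : f.Planar) {i j : Fin m} :
    i < j ↔ (f.leafAt i).1 < (f.leafAt j).1 ∨
      (f.leafAt i).1 = (f.leafAt j).1 ∧ (f.leafAt i).2 < (f.leafAt j).2 := by
  rw [← hf.lt_iff_lt, Prod.Lex.lt_iff]
  rfl

theorem planar_one : (perm (1 : Equiv.Perm (Fin n))).Planar := by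
  intro i j h
  rw [Prod.Lex.lt_iff]
  exact Or.inl h

theorem _root_.JonesThompson.BTree.IsLeaf.append_lt {t : BTree} {u v : List Bool}
    (hu : t.IsLeaf u) (hv : t.IsLeaf v) (h : u < v) (u' v' : List Bool) : u ++ u' < v ++ v' := by
  induction t generalizing u v with
  | leaf =>
    rw [show u = [] from hu, show v = [] from hv] at h
    exact absurd h (lt_irrefl _)
  | node l r ihl ihr =>
    rcases u with _ | ⟨_ | _, u⟩ <;> rcases v with _ | ⟨_ | _, v⟩ <;>
      simp_all [BTree.IsLeaf, List.cons_lt_cons_iff]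

theorem append_lt_append_left (w : List Bool) {u v : List Bool} (h : u < v) :
    w ++ u < w ++ v := by
  induction w with
  | nil => exact h
  | cons a w ih => simpa [List.cons_lt_cons_iff] using ih

theorem Planar.comp {f : SymForest n m} {g : SymForest m k} (hf : f.Planar) (hg : g.Planar) :
    (f.comp g).Planar := by
  intro i j h
  rw [Prod.Lex.lt_iff]
  simp only [comp_leafAt, ofLex_toLex]
  rcases hg.lt_iff.1 h with h1 | ⟨h1, h2⟩
  · rcases hf.lt_iff.1 h1 with h3 | ⟨h3, h4⟩
    · exact Or.inl h3
    · refine Or.inr ⟨h3, ?_⟩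
      have hl := f.isLeaf_leafAt (g.leafAt i).1
      rw [h3] at hl
      exact hl.append_lt (f.isLeaf_leafAt _) h4 _ _
  · rw [h1]
    exact Or.inr ⟨rfl, append_lt_append_left _ h2⟩

/-- If `f` and `g ∘ f` are planar then so is `g`. -/
theorem Planar.of_comp {f : SymForest n m} {g : SymForest m k} (hf : f.Planar)
    (hfg : (f.comp g).Planar) : g.Planar := by
  intro i j h
  by_contra hn
  rcases (not_lt.1 hn).lt_or_eq with h1 | h1
  · rw [Prod.Lex.lt_iff] at h1
    have h2 := hfg h
    refine lt_asymm h2 ?_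
    rw [Prod.Lex.lt_iff]
    simp only [comp_leafAt, ofLex_toLex] at h1 ⊢
    rcases h1 with h1 | ⟨h1, h3⟩
    · rcases hf.lt_iff.1 h1 with h3 | ⟨h3, h4⟩
      · exact Or.inl h3
      · refine Or.inr ⟨h3, ?_⟩
        have hl := f.isLeaf_leafAt (g.leafAt j).1
        rw [h3] at hl
        exact hl.append_lt (f.isLeaf_leafAt _) h4 _ _
    · rw [h1]
      exact Or.inr ⟨rfl, append_lt_append_left _ h3⟩
  · exact h.ne (g.leafAt_injective (toLex_inj.1 h1)).symm

/-- Every symmetric forest becomes planar after renumbering its leaves. -/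
theorem exists_planar (f : SymForest n m) : ∃ g : SymForest n m, g.tree = f.tree ∧ g.Planar := by
  classical
  let s : Finset (Fin n ×ₗ List Bool) := Finset.univ.image fun j => toLex (f.leafAt j)
  have hs : s.card = m := by
    rw [Finset.card_image_of_injective _ (fun i j h => f.leafAt_injective (toLex_inj.1 h)),
      Finset.card_univ, Fintype.card_fin]
  refine ⟨⟨f.tree, fun j => ofLex (s.orderEmbOfFin hs j), ?_, ?_⟩, rfl, ?_⟩
  · intro i j h
    exact (s.orderEmbOfFin hs).injective (ofLex_inj.1 h)
  · intro x
    rw [← f.mem_range_leafAt]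
    have h1 : (∃ j, ofLex (s.orderEmbOfFin hs j) = x) ↔
        toLex x ∈ Set.range (s.orderEmbOfFin hs) := Iff.rfl
    rw [h1, Finset.range_orderEmbOfFin]
    simp [s]
  · exact (s.orderEmbOfFin hs).strictMono

/-- There is a planar forest made of any given trees. -/
theorem exists_of_tree (hn : 0 < n) (h : Fin n → BTree) :
    ∃ (m : ℕ) (f : SymForest n m), 0 < m ∧ f.tree = h ∧ f.Planar := by
  classical
  have hfin : {x : Fin n × List Bool | (h x.1).IsLeaf x.2}.Finite := by
    have : {x : Fin n × List Bool | (h x.1).IsLeaf x.2} =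
        ⋃ i, (fun w => (i, w)) '' {w | (h i).IsLeaf w} := by
      ext ⟨i, w⟩
      simp
    rw [this]
    exact Set.finite_iUnion fun i => (h i).finite_isLeaf.image _
  let e := hfin.toFinset.equivFin
  let f : SymForest n hfin.toFinset.card :=
    { tree := h
      leafAt := fun j => (e.symm j).1
      leafAt_injective := fun i j hij => e.symm.injective (Subtype.ext hij)
      mem_range_leafAt := fun x => by
        constructor
        · rintro ⟨j, rfl⟩
          exact hfin.mem_toFinset.1 (e.symm j).2
        · intro hx
          exact ⟨e ⟨x, hfin.mem_toFinset.2 hx⟩, by simp⟩ }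
  obtain ⟨g, hg, hg'⟩ := f.exists_planar
  refine ⟨_, g, Finset.card_pos.2 ?_, hg, hg'⟩
  obtain ⟨w, hw⟩ := (h ⟨0, hn⟩).exists_isLeaf
  exact ⟨(⟨0, hn⟩, w), hfin.mem_toFinset.2 hw⟩

/-- Two symmetric forests with the same trees differ by a renumbering of the leaves. -/
theorem exists_comp_eq {f : SymForest n m} {g : SymForest n k} (h : f.tree = g.tree) :
    ∃ r : SymForest m k, f.comp r = g := by
  have h1 : ∀ c, ∃ j, f.leafAt j = g.leafAt c := fun c => by
    rw [f.mem_range_leafAt, h]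
    exact g.isLeaf_leafAt c
  choose φ hφ using h1
  refine ⟨⟨fun _ => BTree.leaf, fun c => (φ c, []), ?_, ?_⟩, ?_⟩
  · intro c d hcd
    refine g.leafAt_injective ?_
    rw [← hφ, ← hφ]
    exact congrArg f.leafAt (Prod.ext_iff.1 hcd).1
  · rintro ⟨j, w⟩
    constructor
    · rintro ⟨c, hc⟩
      exact (Prod.ext_iff.1 hc).2.symm
    · rintro (rfl : w = [])
      have h2 : ∃ c, g.leafAt c = f.leafAt j := by
        rw [g.mem_range_leafAt, ← h]
        exact f.isLeaf_leafAt j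
      obtain ⟨c, hc⟩ := h2
      exact ⟨c, Prod.ext (f.leafAt_injective ((hφ c).trans hc)) rfl⟩
  · refine ext_leafAt fun c => ?_
    simp [comp_leafAt, hφ]

theorem comp_tree_eq (f : SymForest 1 m) (p : SymForest m k) (h : List Bool → BTree)
    (hp : p.tree = fun j => h (f.leafAt j).2) (i : Fin 1) :
    (f.comp p).tree i = (f.tree i).graft h := by
  refine BTree.graft_congr fun w hw => ?_
  have hex : ∃ j, f.leafAt j = (i, w) := (f.mem_range_leafAt (i, w)).2 hw
  rw [dif_pos hex, hp]
  dsimp only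
  rw [hex.choose_spec]

/-- Symmetric forests are pairs made of a forest and a permutation of its leaves: every symmetric
forest is `σ ∘ p` for a unique planar forest `p` and a unique permutation `σ`. -/
theorem existsUnique_planar_perm (f : SymForest n m) :
    ∃! x : {p : SymForest n m // p.Planar} × Equiv.Perm (Fin m), f = x.1.1.comp (perm x.2) := by
  have key : ∀ (p : SymForest n m) (σ : Equiv.Perm (Fin m)) (c : Fin m),
      (p.comp (perm σ)).leafAt c = p.leafAt (σ.symm c) := fun p σ c =>
    Prod.ext rfl (List.append_nil _)
  obtain ⟨p, hp, hp'⟩ := f.exists_planar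
  obtain ⟨r, hr⟩ := exists_comp_eq hp
  have h1 : ∀ c, (r.leafAt c).2 = [] := fun c => by
    have h2 : (p.tree (f.leafAt c).1).IsLeaf (f.leafAt c).2 := by
      rw [hp]; exact f.isLeaf_leafAt c
    have h3 := p.isLeaf_leafAt (r.leafAt c).1
    have h4 := congrArg (fun q => q.leafAt c) hr
    simp only [comp_leafAt] at h4
    rw [← h4] at h2
    have h5 := h2.append_inj (u' := []) (v' := (r.leafAt c).2) h3 (by simp)
    simpa using h5
  have hinj : Function.Injective fun c => (r.leafAt c).1 := fun c d hcd =>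
    r.leafAt_injective (Prod.ext hcd ((h1 c).trans (h1 d).symm))
  let σ : Equiv.Perm (Fin m) :=
    (Equiv.ofBijective _ (Finite.injective_iff_bijective.1 hinj)).symm
  have hσ : f = p.comp (perm σ) := by
    rw [← hr]
    congr 1
    exact ext_leafAt fun c => Prod.ext rfl (h1 c)
  refine ⟨(⟨p, hp'⟩, σ), hσ, ?_⟩
  rintro ⟨⟨q, hq⟩, τ⟩ (h : f = q.comp (perm τ))
  have hrange : ∀ (p : SymForest n m) (σ : Equiv.Perm (Fin m)), f = p.comp (perm σ) →
      (Set.range fun j => toLex (p.leafAt j)) = Set.range fun j => toLex (f.leafAt j) := by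
    rintro p σ rfl
    ext x
    constructor
    · rintro ⟨j, rfl⟩
      exact ⟨σ j, by simp [key]⟩
    · rintro ⟨j, rfl⟩
      exact ⟨σ.symm j, by simp [key]⟩
  have hqp : q = p := by
    have h2 := (hq.range_inj hp').1 ((hrange q τ h).trans (hrange p σ hσ).symm)
    exact ext_leafAt fun j => toLex_inj.1 (congrFun h2 j)
  subst hqp
  have h3 : τ = σ := by
    have h4 := comp_left_cancel q (h.symm.trans hσ)
    have h5 : τ.symm = σ.symm := Equiv.ext fun c =>
      (Prod.ext_iff.1 (congrArg (fun q => q.leafAt c) h4)).1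
    rw [← τ.symm_symm, h5, σ.symm_symm]
  rw [h3]

/-- Two trees have a common extension. -/
theorem exists_common (hm : 0 < m) (hk : 0 < k) (t : SymForest 1 m) (s : SymForest 1 k) :
    ∃ (l : ℕ) (p : SymForest m l) (q : SymForest k l), 0 < l ∧ t.comp p = s.comp q := by
  obtain ⟨h, h', e⟩ := BTree.exists_common_graft (t.tree 0) (s.tree 0)
  obtain ⟨a, p, -, hp, -⟩ := exists_of_tree hm fun j => h (t.leafAt j).2
  obtain ⟨b, q, hb, hq, -⟩ := exists_of_tree hk fun j => h' (s.leafAt j).2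
  have htree : (t.comp p).tree = (s.comp q).tree := by
    funext i
    rw [comp_tree_eq t p h hp, comp_tree_eq s q h' hq, Subsingleton.elim i 0, e]
  obtain ⟨r, hr⟩ := exists_comp_eq htree
  exact ⟨b, p.comp r, q, hb, by rw [← comp_assoc, hr]⟩

/-- The tree with two leaves. -/
def caret : SymForest 1 2 where
  tree _ := BTree.node BTree.leaf BTree.leaf
  leafAt := ![(0, [false]), (0, [true])]
  leafAt_injective i j h := by
    fin_cases i <;> fin_cases j <;> simp_all
  mem_range_leafAt x := by
    obtain ⟨i, w⟩ := x
    rw [Subsingleton.elim i 0]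
    rcases w with _ | ⟨_ | _, w⟩ <;> simp [BTree.IsLeaf, Fin.exists_fin_two, eq_comm]

/-- The horizontal concatenation of two symmetric forests, the first one being on the left. -/
def tensor {n' m' : ℕ} (f : SymForest n m) (f' : SymForest n' m') :
    SymForest (n + n') (m + m') where
  tree := Fin.append f.tree f'.tree
  leafAt := Fin.append (fun j => (Fin.castAdd n' (f.leafAt j).1, (f.leafAt j).2))
    fun j => (Fin.natAdd n (f'.leafAt j).1, (f'.leafAt j).2)
  leafAt_injective i j h := by
    induction i using Fin.addCases <;> induction j using Fin.addCases <;>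
      simp only [Fin.append_left, Fin.append_right, Prod.mk.injEq] at h
    · rw [f.leafAt_injective (Prod.ext (Fin.castAdd_injective _ _ h.1) h.2)]
    · have := congrArg Fin.val h.1
      simp at this
      omega
    · have := congrArg Fin.val h.1
      simp at this
      omega
    · rw [f'.leafAt_injective (Prod.ext (Fin.natAdd_injective _ _ h.1) h.2)]
  mem_range_leafAt x := by
    obtain ⟨i, w⟩ := x
    induction i using Fin.addCases with
    | left i =>
      simp only [Fin.append_left]
      rw [← f.mem_range_leafAt (i, w)]
      constructor
      · rintro ⟨j, hj⟩
        induction j using Fin.addCases with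
        | left j =>
          simp only [Fin.append_left, Prod.mk.injEq] at hj
          exact ⟨j, Prod.ext (Fin.castAdd_injective _ _ hj.1) hj.2⟩
        | right j =>
          simp only [Fin.append_right, Prod.mk.injEq] at hj
          have := congrArg Fin.val hj.1
          simp at this
          omega
      · rintro ⟨j, hj⟩
        exact ⟨Fin.castAdd m' j, by simp [hj]⟩
    | right i =>
      simp only [Fin.append_right]
      rw [← f'.mem_range_leafAt (i, w)]
      constructor
      · rintro ⟨j, hj⟩
        induction j using Fin.addCases with
        | left j =>
          simp only [Fin.append_left, Prod.mk.injEq] at hj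
          have := congrArg Fin.val hj.1
          simp at this
          omega
        | right j =>
          simp only [Fin.append_right, Prod.mk.injEq] at hj
          exact ⟨j, Prod.ext (Fin.natAdd_injective _ _ hj.1) hj.2⟩
      · rintro ⟨j, hj⟩
        exact ⟨Fin.natAdd m j, by simp [hj]⟩

end SymForest

/-- The objects of the category of symmetric forests: the positive integers. -/
structure SymForestCat where
  size : ℕ+

/-- The category of symmetric forests; a morphism from `n` to `m` has `n` roots and `m` leaves. -/
noncomputable instance : Category SymForestCat where
  Hom a b := SymForest a.size b.size
  id _ := SymForest.perm 1
  comp q p := q.comp p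
  id_comp := SymForest.perm_comp
  comp_id := SymForest.comp_perm
  assoc := SymForest.comp_assoc

/-- The objects of the category of forests: the positive integers. -/
structure ForestCat where
  size : ℕ+

/-- The category of forests; a morphism is a symmetric forest whose permutation is trivial. -/
noncomputable instance : Category ForestCat where
  Hom a b := {f : SymForest a.size b.size // f.Planar}
  id _ := ⟨SymForest.perm 1, SymForest.planar_one⟩
  comp q p := ⟨q.1.comp p.1, q.2.comp p.2⟩
  id_comp _ := Subtype.ext (SymForest.perm_comp _)
  comp_id _ := Subtype.ext (SymForest.comp_perm _)
  assoc _ _ _ := Subtype.ext (SymForest.comp_assoc _ _ _)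

/-- The inclusion of the category of forests in that of symmetric forests. -/
noncomputable def inclusion : ForestCat ⥤ SymForestCat where
  obj a := ⟨a.size⟩
  map f := f.1
  map_id _ := rfl
  map_comp _ _ := rfl

/-- The object `1`. -/
abbrev SymForestCat.one : SymForestCat := ⟨1⟩

/-- The object `1`. -/
abbrev ForestCat.one : ForestCat := ⟨1⟩

instance : LeftCalculus SymForestCat.one where
  ore {a b} p q := by
    obtain ⟨l, h, k, hl, e⟩ := SymForest.exists_common a.size.pos b.size.pos p q
    exact ⟨⟨⟨l, hl⟩⟩, h, k, e⟩
  weakCancel {_ b} f p q h := ⟨b, 𝟙 b, by rw [SymForest.comp_left_cancel f h]⟩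

/-- Any symmetric forest with source `1` extends to a planar one. -/
theorem exists_planar_comp {a b : ℕ} (f : SymForest a b) :
    ∃ r : SymForest b b, (f.comp r).Planar := by
  obtain ⟨g, hg, hg'⟩ := f.exists_planar
  obtain ⟨r, rfl⟩ := SymForest.exists_comp_eq hg.symm
  exact ⟨r, hg'⟩

/-- A common extension of two forests in the category of symmetric forests can be made planar. -/
theorem exists_planar_common {a b c d : ℕ} {t : SymForest a b} {s : SymForest a c}
    (ht : t.Planar) (hs : s.Planar) {p : SymForest b d} {q : SymForest c d}
    (h : t.comp p = s.comp q) :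
    ∃ r : SymForest d d, (p.comp r).Planar ∧ (q.comp r).Planar ∧
      t.comp (p.comp r) = s.comp (q.comp r) := by
  obtain ⟨r, hr⟩ := exists_planar_comp (t.comp p)
  have e : t.comp (p.comp r) = s.comp (q.comp r) := by
    rw [← SymForest.comp_assoc, h, SymForest.comp_assoc]
  refine ⟨r, ht.of_comp ?_, hs.of_comp ?_, e⟩
  · rwa [← SymForest.comp_assoc]
  · rwa [← e, ← SymForest.comp_assoc]

instance : LeftCalculus ForestCat.one where
  ore {a b} p q := by
    obtain ⟨l, h, k, hl, e⟩ := SymForest.exists_common a.size.pos b.size.pos p.1 q.1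
    obtain ⟨r, h1, h2, h3⟩ := exists_planar_common p.2 q.2 e
    exact ⟨⟨⟨l, hl⟩⟩, ⟨_, h1⟩, ⟨_, h2⟩, Subtype.ext h3⟩
  weakCancel {_ b} f p q h := ⟨b, 𝟙 b, by
    rw [Subtype.ext (SymForest.comp_left_cancel f.1 (congrArg Subtype.val h))]⟩

/-- Thompson's group `V`, the group of fractions of the category of symmetric forests at the
object `1`. -/
abbrev ThompsonV : Type := FractionGroup SymForestCat.one

/-! ### The monoidal functor attached to a morphism `S : Γ → Γ × Γ` -/

section Functor

variable {Γ : Type u} [Group Γ] (S : Γ →* Γ × Γ)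

/-- The component at the leaf with address `w` of the morphism `Γ → Γ^(leaves of t)` obtained by
applying `S` at each interior vertex of the tree `t`: a left edge gives the first component of `S`
and a right edge the second one. -/
def leafHom : List Bool → Γ →* Γ
  | [] => MonoidHom.id Γ
  | false :: w => (leafHom w).comp ((MonoidHom.fst Γ Γ).comp S)
  | true :: w => (leafHom w).comp ((MonoidHom.snd Γ Γ).comp S)

theorem leafHom_append (w w' : List Bool) (g : Γ) :
    leafHom S (w ++ w') g = leafHom S w' (leafHom S w g) := by
  induction w generalizing g with
  | nil => rfl
  | cons a w ih => cases a <;> exact ih _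

/-- The morphism `Γ^n → Γ^m` attached to a symmetric forest with `n` roots and `m` leaves. -/
def forestHom {n m : ℕ} (f : SymForest n m) : (Fin n → Γ) →* (Fin m → Γ) where
  toFun g j := leafHom S (f.leafAt j).2 (g (f.leafAt j).1)
  map_one' := by ext; simp
  map_mul' _ _ := by ext; simp

theorem forestHom_apply {n m : ℕ} (f : SymForest n m) (g : Fin n → Γ) (j : Fin m) :
    forestHom S f g j = leafHom S (f.leafAt j).2 (g (f.leafAt j).1) := rfl

theorem forestHom_comp {n m k : ℕ} (f : SymForest n m) (f' : SymForest m k) (g : Fin n → Γ) :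
    forestHom S (f.comp f') g = forestHom S f' (forestHom S f g) :=
  funext fun _ => leafHom_append S _ _ _

theorem forestHom_caret (g : Fin 1 → Γ) :
    forestHom S SymForest.caret g = ![(S (g 0)).1, (S (g 0)).2] := by
  ext j
  fin_cases j <;> rfl

theorem forestHom_tensor {n m n' m' : ℕ} (f : SymForest n m) (f' : SymForest n' m')
    (g : Fin n → Γ) (g' : Fin n' → Γ) :
    forestHom S (f.tensor f') (Fin.append g g') =
      Fin.append (forestHom S f g) (forestHom S f' g') := by
  ext j
  induction j using Fin.addCases <;> simp [forestHom_apply, SymForest.tensor]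

theorem forestHom_perm {n : ℕ} (σ : Equiv.Perm (Fin n)) (g : Fin n → Γ) (j : Fin n) :
    forestHom S (SymForest.perm σ) g j = g (σ⁻¹ j) := rfl

/-- The symmetric monoidal extension to symmetric forests of the functor `xi`; a permutation `σ`
acts by `(g_1, …, g_n) ↦ (g_{σ⁻¹(1)}, …, g_{σ⁻¹(n)})`. -/
noncomputable def xiSym : SymForestCat ⥤ GrpCat.{u} where
  obj a := GrpCat.of (Fin a.size → Γ)
  map f := GrpCat.ofHom (forestHom S f)
  map_id _ := GrpCat.hom_ext (MonoidHom.ext fun _ => rfl)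
  map_comp _ _ := GrpCat.hom_ext (MonoidHom.ext fun _ => forestHom_comp S _ _ _)

/-- The monoidal functor `Ξ` from forests to groups with `Ξ(1) = Γ` and `Ξ(Y) = S`, where `Y` is
the tree with two leaves. -/
noncomputable def xi : ForestCat ⥤ GrpCat.{u} := inclusion ⋙ xiSym S

/-- The limit group of `Γ_t`, over all trees `t`. -/
abbrev TreeLimitGroup : Type u := LimitGroup (xi S) ForestCat.one

/-- The canonical map from the limit over trees to the limit over symmetric trees. -/
noncomputable def toSymLimit (z : TreeLimitGroup S) : LimitGroup (xiSym S) SymForestCat.one :=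
  Quot.lift (fun z => (LimitGroup.mk (e := SymForestCat.one) (Φ := xiSym S)
      (a := inclusion.obj z.target) z.tree.1 z.val))
    (by
      rintro _ _ ⟨t, x, f⟩
      exact (LimitGroup.mk_ext (Φ := xiSym S) (e := SymForestCat.one) (inclusion.map t) x
        (inclusion.map f)).symm) z

theorem toSymLimit_mk {a : ForestCat} (t : ForestCat.one ⟶ a) (x : (xi S).obj a) :
    toSymLimit S (LimitGroup.mk t x) =
      LimitGroup.mk (e := SymForestCat.one) (Φ := xiSym S) (inclusion.map t) x := rfl

theorem toSymLimit_bijective : Function.Bijective (toSymLimit S) := by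
  constructor
  · intro z z' h
    induction z using LimitGroup.ind with | h a t x =>
    induction z' using LimitGroup.ind with | h b s y =>
    obtain ⟨c, p, q, h1, h2⟩ := (LimitGroup.mk_eq_mk_iff (Φ := xiSym S) (e := SymForestCat.one)
      (t := inclusion.map t) (s := inclusion.map s) (x := x) (y := y)).1 h
    obtain ⟨r, hp, hq, h3⟩ := exists_planar_common t.2 s.2 h1
    refine LimitGroup.mk_eq_mk_iff.2 ⟨⟨c.size⟩, ⟨_, hp⟩, ⟨_, hq⟩, Subtype.ext h3, ?_⟩
    have h4 := congrArg (forestHom S r) h2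
    exact (forestHom_comp S _ _ _).trans (h4.trans (forestHom_comp S _ _ _).symm)
  · intro z
    induction z using LimitGroup.ind with | h a t x =>
    obtain ⟨r, hr⟩ := exists_planar_comp t
    refine ⟨LimitGroup.mk (a := ⟨a.size⟩) ⟨_, hr⟩ (((xiSym S).map (show a ⟶ a from r)).hom x), ?_⟩
    exact LimitGroup.mk_ext (Φ := xiSym S) t x (show a ⟶ a from r)

/-- The canonical identification of the limit over trees with the limit over symmetric trees. -/
noncomputable def treeLimitEquiv :
    TreeLimitGroup S ≃* LimitGroup (xiSym S) SymForestCat.one where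
  toEquiv := Equiv.ofBijective _ (toSymLimit_bijective S)
  map_mul' z z' := by
    obtain ⟨a, t, x, y, rfl, rfl⟩ := LimitGroup.exists_common z z'
    rw [LimitGroup.mk_mul_mk]
    exact (LimitGroup.mk_mul_mk (Φ := xiSym S) (e := SymForestCat.one) (inclusion.map t) x y).symm

/-- The Jones action of Thompson's group `V` on the limit group over trees: the Jones action of
the extension of `Ξ` to symmetric forests, read through the canonical identification. -/
noncomputable def jonesActionV : ThompsonV →* MulAut (TreeLimitGroup S) :=
  (MulAut.congr (treeLimitEquiv S).symm).toMonoidHom.comp (jonesAction (xiSym S) SymForestCat.one)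

/-- The explicit formula
`((θ ∘ t) / (σ ∘ s)) · (s / x) = t / (x permuted by θ⁻¹ σ)`. -/
theorem jonesActionV_apply {a : ForestCat} (t s : ForestCat.one ⟶ a)
    (θ σ : Equiv.Perm (Fin a.size)) (x : Fin a.size → Γ) :
    jonesActionV S
        (FractionGroup.mk (e := SymForestCat.one) (a := ⟨a.size⟩)
          (t.1.comp (SymForest.perm θ)) (s.1.comp (SymForest.perm σ)))
        (LimitGroup.mk s x : LimitGroup (xi S) _) =
      (LimitGroup.mk t (fun i => x ((θ⁻¹ * σ)⁻¹ i)) : LimitGroup (xi S) _) := by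
  apply (treeLimitEquiv S).injective
  have h0 : ∀ z : ThompsonV, ∀ y, treeLimitEquiv S (jonesActionV S z y) =
      jonesAction (xiSym S) _ z (treeLimitEquiv S y) := fun z y =>
    (treeLimitEquiv S).apply_symm_apply _
  rw [h0]
  let b : SymForestCat := ⟨a.size⟩
  have e : (s.1.comp (SymForest.perm σ)).comp (SymForest.perm θ⁻¹) =
      s.1.comp (SymForest.perm (θ⁻¹ * σ)) := by
    rw [SymForest.comp_assoc, SymForest.perm_comp_perm]
  refine (jonesAction_mk (Φ := xiSym S) (e := SymForestCat.one) (a := b) (b := b) (c := b)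
    (t.1.comp (SymForest.perm θ)) (s.1.comp (SymForest.perm σ)) s.1 x
    (SymForest.perm θ⁻¹) (SymForest.perm (θ⁻¹ * σ)) e).trans ?_
  have e2 : (t.1.comp (SymForest.perm θ)).comp (SymForest.perm θ⁻¹) = t.1 := by
    rw [SymForest.comp_assoc, SymForest.perm_comp_perm, inv_mul_cancel, SymForest.comp_perm]
  exact congrArg (fun r => LimitGroup.mk (Φ := xiSym S) (e := SymForestCat.one) (a := b) r _) e2

/-- The category `C_Ξ`: a morphism from `n` to `m` is a symmetric forest with `n` roots and `m`
leaves together with an element of `Γ^m`. -/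
abbrev XiCat : Type := LargeCat (xiSym S)

/-- The group of fractions of the category `C_Ξ` at the object `1`. -/
abbrev XiFractionGroup : Type u := FractionGroup (⟨SymForestCat.one⟩ : XiCat S)

variable (Γ) in
/-- The morphism `g ↦ (g, e)`. -/
abbrev leftEmbedding : Γ →* Γ × Γ := MonoidHom.inl Γ Γ

end Functor

/-! ### The action of Thompson's group on dyadic rationals -/

/-- The set of dyadic rationals in `[0, 1)`. -/
abbrev Q2 : Type := {d : ℚ // 0 ≤ d ∧ d < 1 ∧ ∃ k n : ℕ, d = k / 2 ^ n}

/-- The increasing affine bijection from `[0, 1)` onto the standard dyadic interval of a vertex of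
a binary tree: the interval of the root is `[0, 1)`, and the two descendants of a vertex have the
left half and the right half of its interval. -/
def vertexMap : List Bool → ℚ → ℚ
  | [], u => u
  | false :: w, u => vertexMap w u / 2
  | true :: w, u => (vertexMap w u + 1) / 2

theorem vertexMap_append (w w' : List Bool) (u : ℚ) :
    vertexMap (w ++ w') u = vertexMap w (vertexMap w' u) := by
  induction w with
  | nil => rfl
  | cons a w ih => cases a <;> simp only [List.cons_append, vertexMap, ih]

theorem vertexMap_affine (w : List Bool) (u : ℚ) :
    vertexMap w u = vertexMap w 0 + u / 2 ^ w.length := by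
  induction w with
  | nil => simp [vertexMap]
  | cons a w ih =>
    cases a <;> simp only [vertexMap, List.length_cons, pow_succ] <;> rw [ih] <;> (field_simp; try ring)

theorem vertexMap_mem (w : List Bool) (u : Q2) :
    0 ≤ vertexMap w u ∧ vertexMap w u < 1 ∧ ∃ k n : ℕ, vertexMap w u = k / 2 ^ n := by
  induction w with
  | nil => exact u.2
  | cons a w ih =>
    obtain ⟨h0, h1, k, n, h⟩ := ih
    cases a
    · refine ⟨by simp only [vertexMap]; linarith, by simp only [vertexMap]; linarith, k, n + 1, ?_⟩
      simp only [vertexMap, h, pow_succ]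
      field_simp
    · refine ⟨by simp only [vertexMap]; linarith, by simp only [vertexMap]; linarith,
        k + 2 ^ n, n + 1, ?_⟩
      simp only [vertexMap, h, pow_succ]
      push_cast
      field_simp

theorem vertexMap_inj {t : BTree} {w w' : List Bool} (hw : t.IsLeaf w) (hw' : t.IsLeaf w')
    {u u' : Q2} (h : vertexMap w u = vertexMap w' u') : w = w' ∧ u = u' := by
  induction t generalizing w w' with
  | leaf =>
    rw [show w = [] from hw, show w' = [] from hw'] at h ⊢
    exact ⟨rfl, Subtype.ext h⟩
  | node l r ihl ihr =>
    rcases w with _ | ⟨_ | _, w⟩ <;> rcases w' with _ | ⟨_ | _, w'⟩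
    · exact hw.elim
    · exact hw.elim
    · exact hw.elim
    · exact hw'.elim
    · obtain ⟨rfl, rfl⟩ := ihl hw hw' (by simp only [vertexMap] at h; linarith)
      exact ⟨rfl, rfl⟩
    · have h1 := vertexMap_mem w u
      have h2 := vertexMap_mem w' u'
      simp only [vertexMap] at h
      linarith [h1.2.1, h2.1]
    · exact hw'.elim
    · have h1 := vertexMap_mem w u
      have h2 := vertexMap_mem w' u'
      simp only [vertexMap] at h
      linarith [h1.1, h2.2.1]
    · obtain ⟨rfl, rfl⟩ := ihr hw hw' (by simp only [vertexMap] at h; linarith)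
      exact ⟨rfl, rfl⟩

theorem exists_vertexMap_eq (t : BTree) (d : Q2) :
    ∃ (w : List Bool) (u : Q2), t.IsLeaf w ∧ vertexMap w u = d := by
  induction t generalizing d with
  | leaf => exact ⟨[], d, rfl, rfl⟩
  | node l r ihl ihr =>
    obtain ⟨d, h0, h1, k, n, h⟩ := d
    rcases lt_or_ge d (1 / 2) with hd | hd
    · obtain ⟨w, u, hw, hu⟩ := ihl ⟨2 * d, by linarith, by linarith, 2 * k, n, by
        rw [h]; push_cast; ring⟩
      exact ⟨false :: w, u, hw, by simp only [vertexMap, hu]; ring⟩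
    · have hk : (2 : ℚ) ^ n ≤ 2 * k := by
        rw [h, div_le_div_iff₀ (by norm_num) (by positivity)] at hd
        linarith
      have hk' : 2 ^ n ≤ 2 * k := by exact_mod_cast hk
      obtain ⟨w, u, hw, hu⟩ := ihr ⟨2 * d - 1, by linarith, by linarith, 2 * k - 2 ^ n, n, by
        rw [h, Nat.cast_sub hk']; push_cast; field_simp⟩
      exact ⟨true :: w, u, hw, by simp only [vertexMap, hu]; ring⟩

/-- For a symmetric forest with `n` roots and `m` leaves, cut each of the `n` copies of `[0, 1)`
into the standard dyadic partition of the corresponding tree: the `k`-th of `m` copies of `[0, 1)`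
is mapped by the increasing affine bijection onto the interval of the leaf number `k`. -/
def SymForest.cutMap {n m : ℕ} (f : SymForest n m) (x : Fin m × Q2) : Fin n × Q2 :=
  ((f.leafAt x.1).1, ⟨vertexMap (f.leafAt x.1).2 x.2, vertexMap_mem _ _⟩)

theorem SymForest.cutMap_bijective {n m : ℕ} (f : SymForest n m) :
    Function.Bijective f.cutMap := by
  constructor
  · rintro ⟨j, u⟩ ⟨j', u'⟩ h
    obtain ⟨h1, h2⟩ := Prod.ext_iff.1 h
    dsimp only [SymForest.cutMap] at h1 h2
    have hj := f.isLeaf_leafAt j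
    rw [h1] at hj
    obtain ⟨h3, rfl⟩ := vertexMap_inj hj (f.isLeaf_leafAt j') (Subtype.ext_iff.1 h2)
    rw [f.leafAt_injective (Prod.ext h1 h3)]
  · rintro ⟨i, d⟩
    obtain ⟨w, u, hw, hu⟩ := exists_vertexMap_eq (f.tree i) d
    obtain ⟨j, hj⟩ := (f.mem_range_leafAt (i, w)).2 hw
    refine ⟨(j, u), ?_⟩
    simp only [SymForest.cutMap, hj]
    exact Prod.ext rfl (Subtype.ext hu)

/-- `cutMap` as a bijection. -/
noncomputable def SymForest.cutEquiv {n m : ℕ} (f : SymForest n m) :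
    Fin m × Q2 ≃ Fin n × Q2 := Equiv.ofBijective _ f.cutMap_bijective

theorem SymForest.cutEquiv_comp {n m k : ℕ} (f : SymForest n m) (g : SymForest m k) :
    (f.comp g).cutEquiv = g.cutEquiv.trans f.cutEquiv := by
  refine Equiv.ext fun x => Prod.ext rfl (Subtype.ext ?_)
  exact vertexMap_append _ _ _

/-- The bijection for a symmetric tree, which has a single root. -/
noncomputable def SymForest.treeEquiv {m : ℕ} (t : SymForest 1 m) : Fin m × Q2 ≃ Q2 :=
  t.cutEquiv.trans (Equiv.uniqueProd Q2 (Fin 1))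

theorem SymForest.treeEquiv_comp {m k : ℕ} (f : SymForest 1 m) (g : SymForest m k) :
    (f.comp g).treeEquiv = g.cutEquiv.trans f.treeEquiv := by
  simp only [SymForest.treeEquiv, SymForest.cutEquiv_comp, Equiv.trans_assoc]

/-- The classical action of Thompson's group `V` on dyadic rationals: the fraction `t / s` of two
symmetric trees maps the interval of the leaf number `k` of `s` onto the interval of the leaf number
`k` of `t`, by the increasing affine bijection. -/
noncomputable def thompsonAction : ThompsonV →* Equiv.Perm Q2 where
  toFun v := Quot.lift
    (fun v => (SymForest.treeEquiv (show SymForest 1 v.target.size from v.val)).symm.trans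
      (SymForest.treeEquiv (show SymForest 1 v.target.size from v.tree)))
    (by
      rintro _ _ ⟨t, s, f⟩
      have key : ∀ {m k : ℕ} (t s : SymForest 1 m) (f : SymForest m k),
          s.treeEquiv.symm.trans t.treeEquiv =
            (s.comp f).treeEquiv.symm.trans (t.comp f).treeEquiv := fun t s f => by
        rw [SymForest.treeEquiv_comp, SymForest.treeEquiv_comp]
        ext x
        simp
      exact key t s f) v
  map_one' := by
    change (SymForest.treeEquiv (SymForest.perm 1)).symm.trans
      (SymForest.treeEquiv (SymForest.perm 1)) = Equiv.refl _
    simp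
  map_mul' v v' := by
    induction v using FractionGroup.ind with | h a t s =>
    induction v' using FractionGroup.ind with | h b t' s' =>
    obtain ⟨c, p, q, h⟩ := LeftCalculus.ore s t'
    rw [FractionGroup.mk_mul_mk t s t' s' p q h, ← FractionGroup.mk_ext t s p,
      ← FractionGroup.mk_ext t' s' q, h]
    refine Equiv.ext fun x => ?_
    change _ = SymForest.treeEquiv _ ((SymForest.treeEquiv _).symm
      (SymForest.treeEquiv _ ((SymForest.treeEquiv _).symm x)))
    rw [Equiv.symm_apply_apply]
    rfl

theorem thompsonAction_mk {a : SymForestCat} (t s : SymForest 1 a.size) (k : Fin a.size)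
    (u : Q2) :
    thompsonAction (FractionGroup.mk (e := SymForestCat.one) (a := a) t s)
        ⟨vertexMap (s.leafAt k).2 u, vertexMap_mem _ _⟩ =
      ⟨vertexMap (t.leafAt k).2 u, vertexMap_mem _ _⟩ := by
  change t.treeEquiv (s.treeEquiv.symm (s.treeEquiv (k, u))) = t.treeEquiv (k, u)
  rw [Equiv.symm_apply_apply]

/-! ### The Bernoulli shift -/

/-- The group of finitely supported maps from `X` to `Γ`, with pointwise product. -/
def FinSuppMaps (X : Type v) (Γ : Type u) [Group Γ] : Subgroup (X → Γ) where
  carrier := {g | {x | g x ≠ 1}.Finite}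
  one_mem' := by simp
  mul_mem' {g h} hg hh := by
    refine (Set.Finite.union hg hh).subset fun x hx => ?_
    by_contra hn
    simp only [Set.mem_union, Set.mem_ofPred_eq, not_or, not_not] at hn
    exact hx (by simp [hn.1, hn.2])
  inv_mem' {g} hg := by simpa using hg

/-- The Bernoulli shift of `V` on finitely supported maps, `(v · g)(d) = g(v⁻¹ d)`. -/
noncomputable def bernoulliShift (Γ : Type u) [Group Γ] :
    ThompsonV →* MulAut (FinSuppMaps Q2 Γ) where
  toFun v :=
    { toFun := fun g => ⟨fun d => g.1 (thompsonAction v⁻¹ d),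
        g.2.preimage (thompsonAction v⁻¹).injective.injOn⟩
      invFun := fun g => ⟨fun d => g.1 (thompsonAction v d),
        g.2.preimage (thompsonAction v).injective.injOn⟩
      left_inv := fun g => by
        ext d
        simp
      right_inv := fun g => by
        ext d
        simp
      map_mul' := fun _ _ => rfl }
  map_one' := by
    ext g d
    simp
  map_mul' v v' := by
    ext g d
    simp [mul_inv_rev]

theorem bernoulliShift_apply (Γ : Type u) [Group Γ] (v : ThompsonV) (g : FinSuppMaps Q2 Γ)
    (d : Q2) : (bernoulliShift Γ v g).1 d = g.1 (thompsonAction v⁻¹ d) := rfl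

end JonesThompson

open JonesThompson

/-! For `S(g) = (g, e)`, splitting a leaf labelled `g` leaves `g` on the left child and puts `e` on
the right one. The dyadic interval of the left child has the same left endpoint as that of its
parent. Hence, if each label of a tree is placed at the left endpoint of the interval of its leaf,
the resulting finitely supported map on dyadic rationals is unchanged when the tree grows
(`originMap_forestHom`, `endpointMap_comp`), and it depends only on the class in the limit group.

The induced morphism `limitEndpointHom` is injective because the labels can be read back at the left
endpoints of the leaves of any one tree. It is surjective because every dyadic rational is the left
endpoint of a leaf of some tree (`exists_treeEquiv_zero`), so that all maps supported at one point
are reached, and these generate.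

Equivariance (`limitEndpointHom_jonesAction`) follows by representing the group element as `s / t`
and the limit element as `t / x` over the same tree `t`. The Jones action gives `s / x`, while the
action on dyadic rationals carries the left endpoint of each leaf of `t` to that of the leaf of `s`
with the same number.

The statement on the group of fractions rests on a general fact, valid for any functor `Φ` to
groups: fractions of the larger category split as a semidirect product for the Jones action
(`largeFractionEquiv`). In `(g ∘ t) / (h ∘ s)` only `t / s` and the class of `g⁻¹ h` over `t`
matter. The isomorphism above then turns the Jones action into the Bernoulli shift. -/

namespace JonesThompson

/-! ### Fractions of the larger category as a semidirect product -/

section LargeCategory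

variable {C : Type u} [Category.{v} C] (Φ : C ⥤ GrpCat.{w}) (e : C) [LeftCalculus e]

/-- The morphism of the larger category with the given components. -/
abbrev LargeHom.of {Φ : C ⥤ GrpCat.{w}} {a b : C} (t : a ⟶ b) (x : Φ.obj b) :
    (⟨a⟩ : LargeCat Φ) ⟶ ⟨b⟩ := LargeHom.mk (a := ⟨a⟩) (b := ⟨b⟩) t x

/-- The map sending the fraction `(g ∘ t) / (h ∘ s)` of the larger category to the pair
`(t / (g⁻¹ h), t / s)`. -/
def largeFractionMap (z : FractionGroup (⟨e⟩ : LargeCat Φ)) :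
    LimitGroup Φ e ⋊[jonesAction Φ e] FractionGroup e :=
  Quot.lift (fun z =>
      (⟨LimitGroup.mk z.tree.base (z.tree.label⁻¹ * LargeHom.label z.val),
        FractionGroup.mk z.tree.base (LargeHom.base z.val)⟩ :
        LimitGroup Φ e ⋊[jonesAction Φ e] FractionGroup e))
    (by
      rintro _ _ ⟨t, s, f⟩
      refine SemidirectProduct.ext ?_ (FractionGroup.mk_ext t.base (LargeHom.base s) f.base).symm
      refine (LimitGroup.mk_ext t.base _ f.base).symm.trans (congrArg (LimitGroup.mk _) ?_)
      -- Extending by `f` multiplies both labels on the left by `f.label`, which cancels in the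
      -- quotient `g⁻¹ h`.
      change _ = (f.label * (Φ.map f.base).hom t.label)⁻¹ *
        (f.label * (Φ.map f.base).hom (LargeHom.label s))
      rw [map_mul, map_inv]
      group) z

theorem largeFractionMap_mk {a : C} (t s : e ⟶ a) (g h : Φ.obj a) :
    largeFractionMap Φ e (FractionGroup.mk (LargeHom.of t g) (LargeHom.of s h)) =
      ⟨LimitGroup.mk t (g⁻¹ * h), FractionGroup.mk t s⟩ := rfl

/-- Over a common middle term the product telescopes: `(t / s) · (s / (h⁻¹ k)) = t / (h⁻¹ k)` for
the Jones action, and multiplying on the left by `t / (g⁻¹ h)` gives `t / (g⁻¹ k)`. -/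
theorem largeFractionMap_mul (z z' : FractionGroup (⟨e⟩ : LargeCat Φ)) :
    largeFractionMap Φ e (z * z') = largeFractionMap Φ e z * largeFractionMap Φ e z' := by
  induction z using FractionGroup.ind with | h a t s =>
  induction z' using FractionGroup.ind with | h b t' r =>
  -- The Ore condition is used in the larger category, so the denominator of the first fraction and
  -- the numerator of the second become equal with their labels.
  obtain ⟨c, p, q, h⟩ := LeftCalculus.ore s t'
  rw [← FractionGroup.mk_ext t s p, ← FractionGroup.mk_ext t' r q, ← h,
    FractionGroup.mk_mul_mk _ _ _ _ (𝟙 c) (𝟙 c) rfl, Category.comp_id, Category.comp_id]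
  generalize t ≫ p = t
  generalize s ≫ p = s
  generalize r ≫ q = r
  obtain ⟨t, g⟩ := t
  obtain ⟨s, h⟩ := s
  obtain ⟨r, k⟩ := r
  refine (largeFractionMap_mk Φ e t r g k).trans ?_
  refine Eq.trans ?_ (congrArg₂ (· * ·) (largeFractionMap_mk Φ e t s g h)
    (largeFractionMap_mk Φ e s r h k)).symm
  refine SemidirectProduct.ext ?_ ?_
  · change _ = LimitGroup.mk t (g⁻¹ * h) *
      jonesAction Φ e (FractionGroup.mk t s) (LimitGroup.mk s (h⁻¹ * k))
    rw [jonesAction_mk t s s _ (𝟙 _) (𝟙 _) rfl, Category.comp_id, Φ.map_id]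
    refine Eq.trans (congrArg (LimitGroup.mk t) ?_) (LimitGroup.mk_mul_mk _ _ _).symm
    change _ = g⁻¹ * h * (h⁻¹ * k)
    group
  · change _ = FractionGroup.mk t s * FractionGroup.mk s r
    rw [FractionGroup.mk_mul_mk _ _ _ _ (𝟙 _) (𝟙 _) rfl, Category.comp_id, Category.comp_id]

/-- Triviality of each component becomes an equality of representatives after an extension: the
component in the group of fractions identifies the bases, and then the component in the limit group
identifies the labels. A fraction with equal numerator and denominator is trivial. -/
theorem largeFractionMap_eq_one {z : FractionGroup (⟨e⟩ : LargeCat Φ)}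
    (hz : largeFractionMap Φ e z = 1) : z = 1 := by
  induction z using FractionGroup.ind with | h a t s =>
  obtain ⟨c, p, q, h1, h2⟩ := (Lim.mk_eq_mk_iff (X := SetFunctor.hom e)).1
    (congrArg SemidirectProduct.right hz)
  have h3 : t.base ≫ p = s.base ≫ p := h1.trans ((Category.id_comp q).trans
    ((Category.id_comp q).symm.trans h2.symm))
  -- Extension by `p` with neutral label makes the two bases equal without changing the fraction.
  rw [← FractionGroup.mk_ext t s (LargeHom.of p 1 : a ⟶ ⟨c⟩)] at hz ⊢
  have h4 : (t ≫ (LargeHom.of p 1 : a ⟶ ⟨c⟩)).base = (s ≫ (LargeHom.of p 1 : a ⟶ ⟨c⟩)).base := h3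
  generalize t ≫ (LargeHom.of p 1 : a ⟶ ⟨c⟩) = t at *
  generalize s ≫ (LargeHom.of p 1 : a ⟶ ⟨c⟩) = s at *
  obtain ⟨t, g⟩ := t
  obtain ⟨s, h⟩ := s
  obtain rfl : t = s := h4
  -- The class of `g⁻¹ h` over `t` is trivial, so some `p'` sends `g⁻¹ h` to the neutral element. A
  -- second extension, by `p'`, equates the labels.
  obtain ⟨d, p', q', h5, h6⟩ := LimitGroup.mk_eq_mk_iff.1 (congrArg SemidirectProduct.left hz)
  have h7 : (Φ.map p').hom g = (Φ.map p').hom h := by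
    have h8 : (Φ.map p').hom (g⁻¹ * h) = 1 := h6.trans (map_one _)
    rwa [map_mul, map_inv, inv_mul_eq_one] at h8
  have h9 : (LargeHom.of t g : (⟨e⟩ : LargeCat Φ) ⟶ ⟨c⟩) ≫ (LargeHom.of p' 1 : _ ⟶ ⟨d⟩) =
      (LargeHom.of t h : (⟨e⟩ : LargeCat Φ) ⟶ ⟨c⟩) ≫ (LargeHom.of p' 1 : _ ⟶ ⟨d⟩) :=
    LargeHom.ext rfl (congrArg (1 * ·) h7)
  refine (FractionGroup.mk_ext (LargeHom.of t g) (LargeHom.of t h) (LargeHom.of p' 1)).symm.trans ?_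
  rw [h9]
  exact FractionGroup.mk_self _

theorem largeFractionMap_surjective : Function.Surjective (largeFractionMap Φ e) := by
  rintro ⟨z, v⟩
  induction z using LimitGroup.ind with | h b r x =>
  induction v using FractionGroup.ind with | h c t s =>
  obtain ⟨a, p, q, h⟩ := LeftCalculus.ore r t
  rw [← LimitGroup.mk_ext r x p, ← FractionGroup.mk_ext t s q, ← h]
  generalize r ≫ p = t
  generalize s ≫ q = s
  generalize (Φ.map p).hom x = x
  -- Both components now have the same numerator `t`. Taking `g = 1` and `h = x` gives `g⁻¹ h = x`.
  refine ⟨FractionGroup.mk (LargeHom.of t 1) (LargeHom.of s x), ?_⟩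
  refine (largeFractionMap_mk Φ e t s 1 x).trans (SemidirectProduct.ext ?_ rfl)
  exact congrArg (LimitGroup.mk t) (by group)

/-- The group of fractions of the larger category is the semidirect product of the limit group by
the group of fractions, for the Jones action. -/
noncomputable def largeFractionEquiv :
    FractionGroup (⟨e⟩ : LargeCat Φ) ≃* LimitGroup Φ e ⋊[jonesAction Φ e] FractionGroup e :=
  MulEquiv.ofBijective (MonoidHom.mk' (largeFractionMap Φ e) (largeFractionMap_mul Φ e))
    ⟨(injective_iff_map_eq_one _).2 fun _ => largeFractionMap_eq_one Φ e,
      largeFractionMap_surjective Φ e⟩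

end LargeCategory

/-! ### Values at the left endpoints of the leaves -/

/-- A left edge halves and so preserves vanishing, while a right edge gives a value at least `1/2`.
This is the geometric counterpart of `leafHom_leftEmbedding`: both single out the addresses without
right edges. -/
theorem vertexMap_eq_zero_iff (w : List Bool) {u : ℚ} (hu : 0 ≤ u) :
    vertexMap w u = 0 ↔ u = 0 ∧ true ∉ w := by
  induction w with
  | nil => simp [vertexMap]
  | cons a w ih =>
    have h0 : 0 ≤ vertexMap w u := by
      clear ih
      induction w with
      | nil => exact hu
      | cons b w ih => cases b <;> simp only [vertexMap] <;> positivity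
    cases a
    · simp [vertexMap, ih]
    · have h1 : (vertexMap w u + 1) / 2 ≠ 0 := by positivity
      simp [vertexMap, h1]

/-- The dyadic rational `0`. -/
def Q2.zero : Q2 := ⟨0, le_rfl, one_pos, 0, 0, by simp⟩

/-- The address is a finite binary expansion of `d`: its first digit tells which half contains `d`,
and the doubling map `d ↦ 2d` or `d ↦ 2d - 1` lowers the exponent of the denominator. -/
theorem exists_vertexMap_zero (d : Q2) : ∃ w : List Bool, vertexMap w 0 = d := by
  obtain ⟨d, h0, h1, k, n, h⟩ := d
  induction n generalizing d k with
  | zero =>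
    rw [h, pow_zero, div_one] at h1
    have hk : k = 0 := by exact_mod_cast Nat.lt_one_iff.1 (by exact_mod_cast h1)
    exact ⟨[], by simp [vertexMap, h, hk]⟩
  | succ n ih =>
    rcases lt_or_ge d (1 / 2) with hd | hd
    · obtain ⟨w, hw⟩ := ih (2 * d) (by linarith) (by linarith) k (by
        rw [h, pow_succ]; field_simp)
      exact ⟨false :: w, by simp only [vertexMap, hw]; ring⟩
    · have hk : (2 : ℚ) ^ n ≤ k := by
        rw [h, pow_succ, div_le_div_iff₀ (by norm_num) (by positivity)] at hd
        linarith
      -- This inequality ensures that the natural subtraction `k - 2 ^ n`, the numerator of `2d -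
      -- 1`, is not truncated.
      have hk' : 2 ^ n ≤ k := by exact_mod_cast hk
      obtain ⟨w, hw⟩ := ih (2 * d - 1) (by linarith) (by linarith) (k - 2 ^ n) (by
        rw [h, Nat.cast_sub hk', pow_succ]; push_cast; field_simp)
      exact ⟨true :: w, by simp only [vertexMap, hw]; ring⟩

/-- It suffices to follow the path `w` and hang a trivial tree on the other side of each vertex. -/
theorem BTree.exists_isLeaf_eq (w : List Bool) : ∃ t : BTree, t.IsLeaf w := by
  induction w with
  | nil => exact ⟨leaf, rfl⟩
  | cons a w ih =>
    obtain ⟨t, ht⟩ := ih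
    cases a
    · exact ⟨node t leaf, ht⟩
    · exact ⟨node leaf t, ht⟩

theorem SymForest.treeEquiv_apply_val {m : ℕ} (t : SymForest 1 m) (j : Fin m) (u : Q2) :
    (t.treeEquiv (j, u) : ℚ) = vertexMap (t.leafAt j).2 u := rfl

/-- Every dyadic rational is the left endpoint of the interval of a leaf of some tree. -/
theorem exists_treeEquiv_zero (d : Q2) :
    ∃ (a : SymForestCat) (t : SymForest 1 a.size) (j : Fin a.size),
      t.treeEquiv (j, Q2.zero) = d := by
  obtain ⟨w, hw⟩ := exists_vertexMap_zero d
  obtain ⟨T, hT⟩ := BTree.exists_isLeaf_eq w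
  obtain ⟨m, f, hm, hf, -⟩ := SymForest.exists_of_tree one_pos fun _ : Fin 1 => T
  obtain ⟨j, hj⟩ := (f.mem_range_leafAt (0, w)).2 (by rw [hf]; exact hT)
  refine ⟨⟨⟨m, hm⟩⟩, f, j, Subtype.ext ?_⟩
  refine (f.treeEquiv_apply_val j Q2.zero).trans ?_
  rw [hj]
  exact hw

/-! ### Labelled trees as finitely supported maps -/

variable {Γ : Type u} [Group Γ]

/-- The first component of `S` is the identity and the second is trivial, so a single right edge
kills the label. -/
theorem leafHom_leftEmbedding (w : List Bool) (g : Γ) :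
    leafHom (leftEmbedding Γ) w g = if true ∈ w then 1 else g := by
  induction w generalizing g with
  | nil => simp [leafHom]
  | cons a w ih => cases a <;> simp [leafHom, ih]

open Classical in
/-- The map on `n` copies of `[0, 1)` with the value `x i` at the origin of the copy number `i`,
and trivial elsewhere. -/
noncomputable def originMap {n : ℕ} (x : Fin n → Γ) (p : Fin n × Q2) : Γ :=
  if p.2 = Q2.zero then x p.1 else 1

theorem originMap_zero {n : ℕ} (x : Fin n → Γ) (i : Fin n) : originMap x (i, Q2.zero) = x i :=
  if_pos rfl

theorem originMap_mul {n : ℕ} (x y : Fin n → Γ) : originMap (x * y) = originMap x * originMap y := by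
  funext p
  simp only [originMap, Pi.mul_apply]
  split_ifs <;> simp

/-- This is the point where the choice `S(g) = (g, e)` enters. A label survives along an address
exactly when the address has no right edge, which is exactly when the interval of that leaf begins
at the origin of its root's copy of `[0, 1)`. -/
theorem originMap_forestHom {n m : ℕ} (f : SymForest n m) (x : Fin n → Γ) (p : Fin m × Q2) :
    originMap (forestHom (leftEmbedding Γ) f x) p = originMap x (f.cutEquiv p) := by
  have h : (f.cutEquiv p).2 = Q2.zero ↔ p.2 = Q2.zero ∧ true ∉ (f.leafAt p.1).2 := by
    rw [Subtype.ext_iff, Subtype.ext_iff]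
    exact vertexMap_eq_zero_iff _ p.2.2.1
  simp only [originMap, h, forestHom_apply, leafHom_leftEmbedding]
  by_cases h1 : p.2 = Q2.zero <;> by_cases h2 : true ∈ (f.leafAt p.1).2 <;> simp [h1, h2]
  -- What remains is the origin of a leaf without right edges in its address, where both sides read
  -- the label of its root.
  rfl

theorem originMap_finite {n : ℕ} (x : Fin n → Γ) : {p | originMap x p ≠ 1}.Finite := by
  refine (Set.finite_range fun i : Fin n => (i, Q2.zero)).subset ?_
  rintro ⟨i, u⟩ h
  by_cases hu : u = Q2.zero
  · exact ⟨i, by rw [hu]⟩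
  · exact absurd (if_neg hu) h

/-- The finitely supported map with the value `x j` at the left endpoint of the interval of the
leaf number `j` of the tree `t`. -/
noncomputable def endpointMap {m : ℕ} (t : SymForest 1 m) (x : Fin m → Γ) : FinSuppMaps Q2 Γ :=
  ⟨fun d => originMap x (t.treeEquiv.symm d),
    (originMap_finite x).preimage t.treeEquiv.symm.injective.injOn⟩

theorem endpointMap_apply {m : ℕ} (t : SymForest 1 m) (x : Fin m → Γ) (d : Q2) :
    (endpointMap t x).1 d = originMap x (t.treeEquiv.symm d) := rfl

/-- This invariance under growth of the tree makes `endpointMap` descend to the limit group. -/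
theorem endpointMap_comp {m k : ℕ} (t : SymForest 1 m) (f : SymForest m k) (x : Fin m → Γ) :
    endpointMap (t.comp f) (forestHom (leftEmbedding Γ) f x) = endpointMap t x := by
  refine Subtype.ext (funext fun d => ?_)
  rw [endpointMap_apply, endpointMap_apply, originMap_forestHom, SymForest.treeEquiv_comp]
  simp

theorem endpointMap_mul {m : ℕ} (t : SymForest 1 m) (x y : Fin m → Γ) :
    endpointMap t (x * y) = endpointMap t x * endpointMap t y :=
  Subtype.ext (funext fun _ => congrFun (originMap_mul x y) _)

/-! ### The isomorphism from the limit group and its equivariance -/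

variable (Γ)

/-- The map on the limit group given by `endpointMap`. -/
noncomputable def limitEndpointMap
    (z : LimitGroup (xiSym (leftEmbedding Γ)) SymForestCat.one) : FinSuppMaps Q2 Γ :=
  Quot.lift (fun z => endpointMap (show SymForest 1 z.target.size from z.tree) z.val)
    (by
      rintro _ _ ⟨t, x, f⟩
      exact (endpointMap_comp _ _ _).symm) z

theorem limitEndpointMap_mk {a : SymForestCat} (t : SymForest 1 a.size) (x : Fin a.size → Γ) :
    limitEndpointMap Γ (LimitGroup.mk (e := SymForestCat.one) (a := a)
      (Φ := xiSym (leftEmbedding Γ)) t x) = endpointMap t x := rfl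

/-- `limitEndpointMap` as a group morphism. -/
noncomputable def limitEndpointHom :
    LimitGroup (xiSym (leftEmbedding Γ)) SymForestCat.one →* FinSuppMaps Q2 Γ :=
  MonoidHom.mk' (limitEndpointMap Γ) fun z z' => by
    obtain ⟨a, t, x, y, rfl, rfl⟩ := LimitGroup.exists_common z z'
    rw [LimitGroup.mk_mul_mk]
    exact endpointMap_mul t x y

/-- Injectivity already holds over each single tree, since distinct leaves have distinct left
endpoints. A class in the kernel thus has trivial labels on any representing tree. -/
theorem limitEndpointHom_injective : Function.Injective (limitEndpointHom Γ) := by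
  refine (injective_iff_map_eq_one _).2 fun z hz => ?_
  induction z using LimitGroup.ind with | h a t x =>
  have hx : x = 1 := by
    funext i
    -- Evaluation at the left endpoint of the leaf number `i` recovers the label `x i`.
    have h := congrFun (congrArg Subtype.val hz) (SymForest.treeEquiv t (i, Q2.zero))
    change originMap x ((SymForest.treeEquiv t).symm (SymForest.treeEquiv t (i, Q2.zero))) = 1 at h
    rw [Equiv.symm_apply_apply] at h
    exact (originMap_zero (show Fin a.size → Γ from x) i).symm.trans h
  rw [hx]
  exact LimitGroup.mk_one t

-- A tree with a leaf whose interval starts at `d`, carrying `g` on that leaf and trivial labels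
-- elsewhere, represents the required class.
open Classical in
theorem exists_limitEndpointHom_eq_mulSingle (d : Q2) (g : Γ) :
    ∃ z, (limitEndpointHom Γ z).1 = Pi.mulSingle d g := by
  obtain ⟨a, t, j, rfl⟩ := exists_treeEquiv_zero d
  refine ⟨LimitGroup.mk (e := SymForestCat.one) (a := a) (Φ := xiSym (leftEmbedding Γ)) t
    (Pi.mulSingle j g : Fin a.size → Γ), funext fun d => ?_⟩
  obtain ⟨⟨i, u⟩, rfl⟩ := t.treeEquiv.surjective d
  change originMap (Pi.mulSingle j g : Fin a.size → Γ) (t.treeEquiv.symm (t.treeEquiv (i, u))) = _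
  rw [Equiv.symm_apply_apply]
  by_cases hu : u = Q2.zero <;> by_cases hi : i = j <;>
    simp [originMap, hi, hu]

theorem limitEndpointHom_surjective : Function.Surjective (limitEndpointHom Γ) := by
  classical
  -- Induction on a finite set containing the support: dividing by a map concentrated at `d` with
  -- the value `g d` removes `d` from that set.
  have key : ∀ (s : Finset Q2) (g : FinSuppMaps Q2 Γ), (∀ d ∉ s, g.1 d = 1) →
      ∃ z, limitEndpointHom Γ z = g := by
    intro s
    induction s using Finset.induction_on with
    | empty =>
      intro g hg
      exact ⟨1, (map_one _).trans (Subtype.ext (funext fun d => (hg d (by simp)).symm))⟩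
    | insert d s _ ih =>
      intro g hg
      obtain ⟨z, hz⟩ := exists_limitEndpointHom_eq_mulSingle Γ d (g.1 d)
      obtain ⟨z', hz'⟩ := ih ((limitEndpointHom Γ z)⁻¹ * g) (fun c hc => by
        change ((limitEndpointHom Γ z).1 c)⁻¹ * g.1 c = 1
        rw [hz, inv_mul_eq_one]
        by_cases hcd : c = d
        · rw [hcd, Pi.mulSingle_eq_same]
        · rw [Pi.mulSingle_eq_of_ne hcd, hg c (by simp [hcd, hc])])
      exact ⟨z * z', by rw [map_mul, hz', mul_inv_cancel_left]⟩
  intro g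
  exact key g.2.toFinset g fun d hd => by
    by_contra h
    exact hd (g.2.mem_toFinset.2 h)

/-- With `v = s / t` and `z = t / x`, both sides carry the label `x j` at the left endpoint of the
leaf number `j` of `s`. -/
theorem limitEndpointHom_jonesAction (v : ThompsonV)
    (z : LimitGroup (xiSym (leftEmbedding Γ)) SymForestCat.one) :
    limitEndpointHom Γ (jonesAction (xiSym (leftEmbedding Γ)) SymForestCat.one v z) =
      bernoulliShift Γ v (limitEndpointHom Γ z) := by
  induction v using FractionGroup.ind with | h b s t =>
  induction z using LimitGroup.ind with | h c r x =>
  obtain ⟨a, p, q, h⟩ := LeftCalculus.ore t r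
  rw [← FractionGroup.mk_ext s t p, ← LimitGroup.mk_ext r x q, h]
  generalize s ≫ p = s
  generalize r ≫ q = t
  generalize ((xiSym (leftEmbedding Γ)).map q).hom x = x
  refine (congrArg (limitEndpointHom Γ) (Lim.act_mk_same
    (X := SetFunctor.ofGrp (xiSym (leftEmbedding Γ))) s t x)).trans ?_
  refine Subtype.ext (funext fun d => ?_)
  rw [bernoulliShift_apply, FractionGroup.mk_inv]
  -- Here `v⁻¹ = t / s` acts by the coordinates of `s` followed by the parametrization of `t`.
  -- Reading the result in the coordinates of `t` cancels the latter.
  change originMap x ((SymForest.treeEquiv s).symm d) = originMap x ((SymForest.treeEquiv t).symm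
    (SymForest.treeEquiv t ((SymForest.treeEquiv s).symm d)))
  rw [Equiv.symm_apply_apply]

/-- The limit group over symmetric trees is the group of finitely supported maps on dyadic
rationals. -/
noncomputable def limitEndpointEquiv :
    LimitGroup (xiSym (leftEmbedding Γ)) SymForestCat.one ≃* FinSuppMaps Q2 Γ :=
  MulEquiv.ofBijective (limitEndpointHom Γ)
    ⟨limitEndpointHom_injective Γ, limitEndpointHom_surjective Γ⟩

end JonesThompson

open JonesThompson

theorem mainTheorem7 (Γ : Type*) [Group Γ] :
    (∃ Ψ : TreeLimitGroup (leftEmbedding Γ) ≃* FinSuppMaps Q2 Γ,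
      ∀ (v : ThompsonV) (z : TreeLimitGroup (leftEmbedding Γ)),
        Ψ (jonesActionV (leftEmbedding Γ) v z) = bernoulliShift Γ v (Ψ z)) ∧
    Nonempty
      (XiFractionGroup (leftEmbedding Γ) ≃* FinSuppMaps Q2 Γ ⋊[bernoulliShift Γ] ThompsonV) := by
  refine ⟨⟨(treeLimitEquiv (leftEmbedding Γ)).trans (limitEndpointEquiv Γ), fun v z => ?_⟩,
    -- The category `C_Ξ` is built on symmetric forests, so the limit over symmetric trees appears
    -- directly. The isomorphism is transported with the identity on `V`, and the condition left to
    -- check is equivariance.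
    ⟨(largeFractionEquiv (xiSym (leftEmbedding Γ)) SymForestCat.one).trans
      (SemidirectProduct.congr (limitEndpointEquiv Γ) (MulEquiv.refl _) fun v => ?_)⟩⟩
  -- The action on the limit over planar trees is the conjugate of the symmetric one by
  -- `treeLimitEquiv`, so applying this identification afterwards leaves the symmetric Jones action.
  · refine Eq.trans (congrArg (limitEndpointHom Γ) ?_) (limitEndpointHom_jonesAction Γ v _)
    exact (treeLimitEquiv (leftEmbedding Γ)).apply_symm_apply _
  · exact MulEquiv.ext fun z => limitEndpointHom_jonesAction Γ v z
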